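/- Let $M$, $N$ be (smooth, Hausdorff) Riemannian manifolds of the same dimension $n$, and let $\Omega\subset M$, $\Lambda\subset N$ be domains (nonempty connected open sets, not necessarily bounded), with closures $\overline\Omega$, $\overline\Lambda$. Let $c:\Omega\times\Lambda\to\mathbf R$ be a cost function such that: (A0) $c\in C^4_{\rm loc}(\overline\Omega\times\overline\Lambda)$, i.e. $c$ is $C^4$ on $\Omega\times\Lambda$ and its derivatives of order $\le 4$ (in local coordinates) extend continuously to $\overline\Omega\times\overline\Lambda$; below, $c$ and its derivatives at boundary points are these extensions; (A1) for each $x\in\Omega$ the map $y\mapsto-\nabla_xc(x,y)\in T_xM$ is injective on $\overline\Lambda$, and for each $y\in\Lambda$ the map $x\mapsto-\nabla_yc(x,y)\in T_yN$ is injective on $\overline\Omega$; (A2) $\det D^2_{xy}c(x,y)\ne0$ for all $x\in\overline\Omega$, $y\in\overline\Lambda$. For $x\in\Omega$, $S\subset\overline\Lambda$, say that $S$ is *$c$-convex with respect to $x$* if $\{-\nabla_xc(x,y): y\in S\}$ is a convex subset of $T_xM$. Assume that $\Lambda$ is $c$-convex with respect to every $x\in\Omega$, and symmetrically that $\Omega$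 is $c^*$-convex with respect to $\Lambda$, i.e. $\{-\nabla_yc(x,y): x\in\Omega\}\subset T_yN$ is convex for every $y\in\Lambda$. Let $c\text{-Exp}_x(p)=y$ for $p=-\nabla_xc(x,y)$, $y\in\Lambda$, and for $(x,y)\in\Omega\times\Lambda$, $\eta,\xi\in T_xM$, $p=-\nabla_xc(x,y)$, put $$\mathfrak S_c(x,y)(\eta,\xi)=\frac{d^2}{dt^2}\Big|_{t=0}\big[-D^2_{xx}c\big](x,c\text{-Exp}_x(p+t\xi))\,\eta\,\eta ,$$ where $D^2_{xx}$ is the Riemannian Hessian (second derivative in normal coordinates at $x$). Assume moreover (A3W) there is $C_0\ge0$ with $\mathfrak S_c(x,y)(\eta,\xi)\ge C_0|\eta|^2|\xi|^2$ for all $(x,y)\in\Omega\times\Lambda$ and all $\eta\perp\xi$ in $T_xM$. Let $\phi$ be a *$c$-convex function on $\Omega$ indexed by $\Lambda$*: there is $v:\overline\Lambda\to\mathbf R\cup\{+\infty\}$ such that for each $x\in\Omega$ $$\phi(x)=\sup_{y\in\Lambda}\big(-c(x,y)-v(y)\big)=\sup_{y\in\overline\Lambda}\big(-c(x,y)-v(y)\big)$$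 and $\phi(x)+v(y)=-c(x,y)$ for some $y\in\overline\Lambda$. For $x\in\Omega$ let $$G_\phi(x)=\Big\{y\in\overline\Lambda:\ \phi(x)+\sup_{z\in\Omega}\big(-c(z,y)-\phi(z)\big)=-c(x,y)\Big\}$$ be its contact set at $x$. Then for every $x\in\Omega$ the contact set $G_\phi(x)$ is $c$-convex with respect to $x$, and $G_\phi(x)$ is (nonempty and) connected, where, in case $G_\phi(x)\not\subset\Lambda$, it is also assumed that $\overline\Lambda$ is $c$-convex with respect to $x$ (which is automatic if $\overline\Lambda$ is compact). -/

import Mathlib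

open Set Filter Topology
open scoped Manifold ContDiff

noncomputable section

/-- The model space `ℝⁿ`. -/
abbrev Eu (n : ℕ) : Type := EuclideanSpace ℝ (Fin n)

/-- A smooth Riemannian metric on the (boundaryless) smooth `n`-manifold `M`. -/
abbrev RiemMetric (n : ℕ) (M : Type*) [TopologicalSpace M] [ChartedSpace (Eu n) M]
    [IsManifold 𝓘(ℝ, Eu n) ∞ M] :=
  Bundle.ContMDiffRiemannianMetric 𝓘(ℝ, Eu n) ∞ (Eu n)
    (fun x : M => TangentSpace 𝓘(ℝ, Eu n) x)

section OneManifold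

variable {n : ℕ} {M : Type*} [TopologicalSpace M] [ChartedSpace (Eu n) M]
  [IsManifold 𝓘(ℝ, Eu n) ∞ M]

/-- The Riemannian gradient `∇f(x) ∈ T_xM`: the inverse of `v ↦ g_x(v, ·)` applied to the
differential of `f` at `x`. -/
def riemGrad (g : RiemMetric n M) (f : M → ℝ) (x : M) : TangentSpace 𝓘(ℝ, Eu n) x :=
  ContinuousLinearMap.inverse (g.inner x) (mfderiv 𝓘(ℝ, Eu n) 𝓘(ℝ, ℝ) f x)

/-- The defining property of the gradient, `g_x(∇f(x), w) = df_x(w)`. -/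
theorem inner_riemGrad (g : RiemMetric n M) (f : M → ℝ) (x : M)
    (w : TangentSpace 𝓘(ℝ, Eu n) x) :
    g.inner x (riemGrad g f x) w = mfderiv 𝓘(ℝ, Eu n) 𝓘(ℝ, ℝ) f x w := by
  have key : ∀ (B : Eu n →L[ℝ] Eu n →L[ℝ] ℝ), (∀ v, v ≠ 0 → 0 < B v v) →
      ∀ (L : Eu n →L[ℝ] ℝ) (w : Eu n), B (ContinuousLinearMap.inverse B L) w = L w := by
    intro B hB L w
    have hinj : Function.Injective B.toLinearMap := by
      rw [← LinearMap.ker_eq_bot, LinearMap.ker_eq_bot']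
      intro v hv
      by_contra h
      have h1 := hB v h
      have h2 : B v = 0 := hv
      rw [h2] at h1
      simp at h1
    have hdim : Module.finrank ℝ (Eu n) = Module.finrank ℝ (Eu n →L[ℝ] ℝ) := by
      rw [← (LinearMap.toContinuousLinearMap (𝕜 := ℝ) (E := Eu n) (F' := ℝ)).finrank_eq]
      exact Subspace.dual_finrank_eq.symm
    let e := (LinearEquiv.ofInjectiveOfFinrankEq B.toLinearMap hinj hdim).toContinuousLinearEquiv
    have he : B = (e : Eu n →L[ℝ] Eu n →L[ℝ] ℝ) := by
      ext v : 1
      rfl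
    rw [he, ContinuousLinearMap.inverse_equiv]
    simp
  exact key (g.inner x) (g.pos x) (mfderiv 𝓘(ℝ, Eu n) 𝓘(ℝ, ℝ) f x) w

/-- The coefficients of the metric in the chart of `M` centred at `x₀`: at the coordinate point `u`
it is the bilinear form `(a, b) ↦ g(∂_a, ∂_b)`. -/
def metricInChart (g : RiemMetric n M) (x₀ : M) (u a b : Eu n) : ℝ :=
  g.inner ((extChartAt 𝓘(ℝ, Eu n) x₀).symm u)
    (mfderiv 𝓘(ℝ, Eu n) 𝓘(ℝ, Eu n) (extChartAt 𝓘(ℝ, Eu n) x₀).symm u a)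
    (mfderiv 𝓘(ℝ, Eu n) 𝓘(ℝ, Eu n) (extChartAt 𝓘(ℝ, Eu n) x₀).symm u b)

/-- The directional derivative `(∂_w g)(a, b)` at `x`, in the chart of `M` centred at `x`. -/
def metricDeriv (g : RiemMetric n M) (x : M) (w a b : Eu n) : ℝ :=
  fderiv ℝ (fun u => metricInChart g x u a b) (extChartAt 𝓘(ℝ, Eu n) x x) w

/-- The Riemannian Hessian of `f` at `x`, on `η, ζ ∈ T_xM`; equivalently, the second derivative of
`f` in Riemannian normal coordinates at `x`.  In the chart centred at `x` (whose coordinates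
are the ones that identify `T_xM` with `ℝⁿ`) it is `∂_η ∂_ζ f - df(Γ(η, ζ))`, where the Christoffel
symbol `Γ` is given by `2 g(Γ(η, ζ), w) = (∂_η g)(ζ, w) + (∂_ζ g)(η, w) - (∂_w g)(η, ζ)`, and
`df(Γ(η, ζ)) = g(Γ(η, ζ), ∇f)`. -/
def riemHess (g : RiemMetric n M) (f : M → ℝ) (x : M) (η ζ : TangentSpace 𝓘(ℝ, Eu n) x) : ℝ :=
  fderiv ℝ (fderiv ℝ (fun u : Eu n => f ((extChartAt 𝓘(ℝ, Eu n) x).symm u)))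
      (extChartAt 𝓘(ℝ, Eu n) x x) η ζ
    - (metricDeriv g x η ζ (riemGrad g f x) + metricDeriv g x ζ η (riemGrad g f x)
        - metricDeriv g x (riemGrad g f x) η ζ) / 2

end OneManifold

section Cost

variable {n : ℕ} {M N : Type*}
  [TopologicalSpace M] [ChartedSpace (Eu n) M] [IsManifold 𝓘(ℝ, Eu n) ∞ M]
  [TopologicalSpace N] [ChartedSpace (Eu n) N] [IsManifold 𝓘(ℝ, Eu n) ∞ N]

/-- The cost read in the chart of `M` centred at `x₀` and the chart of `N` centred at `y₀`. -/
def costInCharts (c : M → N → ℝ) (x₀ : M) (y₀ : N) (p : Eu n × Eu n) : ℝ :=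
  c ((extChartAt 𝓘(ℝ, Eu n) x₀).symm p.1) ((extChartAt 𝓘(ℝ, Eu n) y₀).symm p.2)

/-- **A0**: `c ∈ C⁴_loc(Ω̄ × Λ̄)`.  The cost is `C⁴` on `Ω × Λ`, and its derivatives of order at
most `4` (in local coordinates) extend continuously to `Ω̄ × Λ̄`; the values of `c` on `Ω̄ × Λ̄` are
those of its continuous extension. -/
structure CostA0 (c : M → N → ℝ) (Ω : Set M) (Λ : Set N) : Prop where
  contMDiffOn : ContMDiffOn (𝓘(ℝ, Eu n).prod 𝓘(ℝ, Eu n)) 𝓘(ℝ, ℝ) 4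
    (fun p : M × N => c p.1 p.2) (Ω ×ˢ Λ)
  tendsto : ∀ x₀ ∈ closure Ω, ∀ y₀ ∈ closure Λ,
    Tendsto (fun p : M × N => c p.1 p.2) (𝓝[Ω ×ˢ Λ] (x₀, y₀)) (𝓝 (c x₀ y₀))
  tendsto_deriv : ∀ x₀ ∈ closure Ω, ∀ y₀ ∈ closure Λ, ∀ k : ℕ, k ≤ 4 →
    ∃ L, Tendsto
      (fun p : M × N => iteratedFDeriv ℝ k (costInCharts (n := n) c x₀ y₀)
        (extChartAt 𝓘(ℝ, Eu n) x₀ p.1, extChartAt 𝓘(ℝ, Eu n) y₀ p.2))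
      (𝓝[Ω ×ˢ Λ] (x₀, y₀)) (𝓝 L)

/-- The vector `-∇ₓc(x, y) ∈ T_xM`. -/
def negGrad (g : RiemMetric n M) (c : M → N → ℝ) (x : M) (y : N) :
    TangentSpace 𝓘(ℝ, Eu n) x :=
  -riemGrad g (fun z => c z y) x

/-- **A1**: `y ↦ -∇ₓc(x, y)` is injective on `Λ̄` for each `x ∈ Ω`, and `x ↦ -∇_y c(x, y)` is
injective on `Ω̄` for each `y ∈ Λ`. -/
def CostA1 (g : RiemMetric n M) (h : RiemMetric n N) (c : M → N → ℝ) (Ω : Set M) (Λ : Set N) :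
    Prop :=
  (∀ x ∈ Ω, InjOn (fun y => negGrad g c x y) (closure Λ)) ∧
  (∀ y ∈ Λ, InjOn (fun x => negGrad h (fun y x => c x y) y x) (closure Ω))

/-- The matrix of mixed second partial derivatives `∂²c / ∂xᵢ∂yⱼ` at `(x, y)`, in the charts
centred at `x₀` and `y₀`. -/
def mixedHess (c : M → N → ℝ) (x₀ : M) (y₀ : N) (x : M) (y : N) : Matrix (Fin n) (Fin n) ℝ :=
  Matrix.of fun i j =>
    fderiv ℝ
      (fun w : Eu n =>
        fderiv ℝ (fun u : Eu n => costInCharts c x₀ y₀ (u, w)) (extChartAt 𝓘(ℝ, Eu n) x₀ x)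
          (EuclideanSpace.single i 1))
      (extChartAt 𝓘(ℝ, Eu n) y₀ y) (EuclideanSpace.single j 1)

/-- **A2**: `det D²_{xy} c ≠ 0` on `Ω̄ × Λ̄`, where at boundary points `D²_{xy} c` means the
continuous extension. -/
def CostA2 (c : M → N → ℝ) (Ω : Set M) (Λ : Set N) : Prop :=
  ∀ x₀ ∈ closure Ω, ∀ y₀ ∈ closure Λ, ∃ A : Matrix (Fin n) (Fin n) ℝ, A.det ≠ 0 ∧
    Tendsto (fun p : M × N => mixedHess (n := n) c x₀ y₀ p.1 p.2) (𝓝[Ω ×ˢ Λ] (x₀, y₀)) (𝓝 A)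

/-- The `c`-exponential map on its domain `{-∇ₓc(x, y) | y ∈ Λ}`: `c-Exp_x p` is the `y ∈ Λ` with
`p = -∇ₓc(x, y)`.  The point `y₀` only serves to give the map a value off this domain. -/
def cExp (g : RiemMetric n M) (c : M → N → ℝ) (Λ : Set N) (y₀ : N) (x : M)
    (p : TangentSpace 𝓘(ℝ, Eu n) x) : N :=
  haveI : Nonempty N := ⟨y₀⟩
  Function.invFunOn (fun y => negGrad g c x y) Λ p

/-- The `c`-sectional curvature
`𝔖_c(x, y)(η, ξ) = d²/dt²|₀ [-D²ₓₓ c](x, c-Exp_x(p + tξ)) η η`, with `p = -∇ₓc(x, y)`. -/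
def cSectional (g : RiemMetric n M) (c : M → N → ℝ) (Λ : Set N) (x : M) (y : N)
    (η ξ : TangentSpace 𝓘(ℝ, Eu n) x) : ℝ :=
  iteratedDeriv 2
    (fun t : ℝ => -riemHess g (fun z => c z (cExp g c Λ y x (negGrad g c x y + t • ξ))) x η η) 0

/-- **A3W**. -/
def CostA3W (g : RiemMetric n M) (c : M → N → ℝ) (Ω : Set M) (Λ : Set N) : Prop :=
  ∃ C₀ : ℝ, 0 ≤ C₀ ∧ ∀ x ∈ Ω, ∀ y ∈ Λ, ∀ η ξ : TangentSpace 𝓘(ℝ, Eu n) x,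
    g.inner x η ξ = 0 → C₀ * g.inner x η η * g.inner x ξ ξ ≤ cSectional g c Λ x y η ξ

/-- The set `S` is `c`-convex with respect to `x`: its inverse image under `c-Exp_x`, that is
`{-∇ₓc(x, y) | y ∈ S}`, is a convex subset of `T_xM`. -/
def IsCConvexAt (g : RiemMetric n M) (c : M → N → ℝ) (S : Set N) (x : M) : Prop :=
  Convex ℝ ((fun y => negGrad g c x y) '' S)

end Cost

section CConvexFunctions

variable {X Y : Type*}

/-- The `c`-Legendre transformation `L^c v (x) = sup_{y ∈ S} (-c(x, y) - v(y))`. -/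
def cLegendre (c : X → Y → ℝ) (S : Set Y) (v : Y → EReal) (x : X) : EReal :=
  ⨆ y ∈ S, ((-c x y : ℝ) : EReal) - v y

/-- `φ` is a `c`-convex function on `Ω` indexed by `Λ`: `φ = L^c v` for a function
`v : Λ → ℝ ∪ {+∞}`, and the supremum is attained in `Λ̄` at each `x ∈ Ω`.  For the latter to make
sense `v` has values on `Λ̄`, and those at the boundary are such that the supremum does not change
when it is taken over `Λ̄`.  Attainment forces `φ` to be finite. -/
def IsCConvexFunction [TopologicalSpace Y] (c : X → Y → ℝ) (Ω : Set X) (Λ : Set Y) (φ : X → ℝ) :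
    Prop :=
  ∃ v : Y → EReal, (∀ y ∈ closure Λ, v y ≠ ⊥) ∧
    (∀ x ∈ Ω, (φ x : EReal) = cLegendre c Λ v x) ∧
    (∀ x ∈ Ω, (φ x : EReal) = cLegendre c (closure Λ) v x) ∧
    (∀ x ∈ Ω, ∃ y ∈ closure Λ, (φ x : EReal) + v y = ((-c x y : ℝ) : EReal))

/-- The contact set `G_φ(x) = {y ∈ Λ̄ | φ(x) + L^{c*}φ(y) = -c(x, y)}`. -/
def contactSet [TopologicalSpace Y] (c : X → Y → ℝ) (Ω : Set X) (Λ : Set Y) (φ : X → ℝ) (x : X) :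
    Set Y :=
  {y ∈ closure Λ |
    (φ x : EReal) + cLegendre (fun y x => c x y) Ω (fun z => (φ z : EReal)) y
      = ((-c x y : ℝ) : EReal)}

end CConvexFunctions

end

/-! The metric identifies `-∇ₓc(x, y)` with the covector `∂ₓc(x, y)`, so convexity is tested on
covectors. The contact set at `x` is an intersection of sublevel sets of the functions
`y ↦ c(x, y) - c(z, y)`, `z ∈ Ω`, hence convex once these are quasiconvex in the coordinate
`p = ∂ₓc(x, y)` (Loeper's maximum principle). In a critical direction, the second derivative of such
a function in `p` is a difference of second derivatives of `c` in `y` at the ends `x`, `z` of a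
`c*`-segment; it is nonnegative by (A3W), which is symmetric in the two variables.
A function without critical points whose Hessian is nonnegative on the kernel of its differential is
quasiconvex. Finally, the inverse of `y ↦ ∂ₓc(x, y)` is continuous up to the boundary of `Λ`,
so the contact set is a continuous image of a convex set. -/

section DirectionalDerivatives

variable {V : Type*} [NormedAddCommGroup V] [NormedSpace ℝ V] {F G : V → ℝ} {p : V}

/-- The derivative of `F` in the direction `v`, as a function of the base point. -/
noncomputable def dirDeriv (v : V) (F : V → ℝ) : V → ℝ := fun p => fderiv ℝ F p v

theorem contDiffAt_dirDeriv {m k : WithTop ℕ∞} (hF : ContDiffAt ℝ k F p) (hmk : m + 1 ≤ k)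
    (v : V) : ContDiffAt ℝ m (dirDeriv v F) p :=
  (hF.fderiv_right hmk).clm_apply contDiffAt_const

theorem dirDeriv_eventuallyEq (h : F =ᶠ[𝓝 p] G) (v : V) :
    dirDeriv v F =ᶠ[𝓝 p] dirDeriv v G := by
  filter_upwards [h.fderiv (𝕜 := ℝ)] with q hq using congrArg (· v) hq

theorem dirDeriv_dirDeriv_apply (hF : ContDiffAt ℝ 2 F p) (v w : V) :
    dirDeriv v (dirDeriv w F) p = fderiv ℝ (fderiv ℝ F) p v w := by
  have h : DifferentiableAt ℝ (fderiv ℝ F) p :=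
    (hF.fderiv_right (m := 1) le_rfl).differentiableAt one_ne_zero
  change fderiv ℝ (fun q => fderiv ℝ F q w) p v = _
  simp [fderiv_clm_apply h (differentiableAt_const w)]

theorem dirDeriv_comm (hF : ContDiffAt ℝ 2 F p) (v w : V) :
    dirDeriv v (dirDeriv w F) p = dirDeriv w (dirDeriv v F) p := by
  rw [dirDeriv_dirDeriv_apply hF, dirDeriv_dirDeriv_apply hF]
  exact (hF.isSymmSndFDerivAt (by simp)).eq v w

theorem eventually_dirDeriv_comm (hF : ContDiffAt ℝ 2 F p) (v w : V) :
    dirDeriv v (dirDeriv w F) =ᶠ[𝓝 p] dirDeriv w (dirDeriv v F) := by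
  filter_upwards [hF.eventually (by simp)] with q hq using dirDeriv_comm hq v w

theorem dirDeriv_dirDeriv_dirDeriv_comm (hF : ContDiffAt ℝ 3 F p) (v w : V) :
    dirDeriv v (dirDeriv w (dirDeriv w F)) p = dirDeriv w (dirDeriv w (dirDeriv v F)) p := by
  rw [dirDeriv_comm (contDiffAt_dirDeriv hF le_rfl w) v w]
  exact (dirDeriv_eventuallyEq
    (eventually_dirDeriv_comm (hF.of_le (by norm_num)) v w) w).eq_of_nhds

theorem dirDeriv_fourth_comm (hF : ContDiffAt ℝ 4 F p) (v w : V) :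
    dirDeriv v (dirDeriv v (dirDeriv w (dirDeriv w F))) p =
      dirDeriv w (dirDeriv w (dirDeriv v (dirDeriv v F))) p := by
  have third : dirDeriv v (dirDeriv w (dirDeriv w F)) =ᶠ[𝓝 p]
      dirDeriv w (dirDeriv w (dirDeriv v F)) := by
    filter_upwards [hF.eventually (by simp)] with q hq
    exact dirDeriv_dirDeriv_dirDeriv_comm (hq.of_le (by norm_num)) v w
  rw [(dirDeriv_eventuallyEq third v).eq_of_nhds]
  exact dirDeriv_dirDeriv_dirDeriv_comm (contDiffAt_dirDeriv hF (by norm_num) v) v w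

theorem iteratedDeriv_two_comp {γ : ℝ → V} {t : ℝ} (hF : ContDiffAt ℝ 2 F (γ t))
    (hγ : ContDiffAt ℝ 2 γ t) :
    iteratedDeriv 2 (fun r => F (γ r)) t =
      dirDeriv (deriv γ t) (dirDeriv (deriv γ t) F) (γ t)
        + dirDeriv (iteratedDeriv 2 γ t) F (γ t) := by
  rw [dirDeriv_dirDeriv_apply hF]
  refine (iteratedDeriv_vcomp_two hF hγ).trans ?_
  rw [iteratedFDeriv_two_apply]
  rfl

theorem iteratedDeriv_two_comp_add_smul (hF : ContDiffAt ℝ 2 F p) (v : V) :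
    iteratedDeriv 2 (fun r : ℝ => F (p + r • v)) 0 = fderiv ℝ (fderiv ℝ F) p v v := by
  have hderiv : deriv (fun r : ℝ => p + r • v) = fun _ => v := by
    ext r
    simpa using (((hasDerivAt_id r).smul_const v).const_add p).deriv
  rw [iteratedDeriv_two_comp (γ := fun r => p + r • v) (by simpa using hF) (by fun_prop),
    iteratedDeriv_succ', hderiv, iteratedDeriv_const, if_neg one_ne_zero, zero_smul, add_zero,
    dirDeriv_dirDeriv_apply hF]
  simp [dirDeriv]

end DirectionalDerivatives

section ProductCurves

variable {E₁ E₂ : Type*} [NormedAddCommGroup E₁] [NormedSpace ℝ E₁]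
  [NormedAddCommGroup E₂] [NormedSpace ℝ E₂]

theorem iteratedDeriv_prodMk {k : ℕ} {f : ℝ → E₁} {g : ℝ → E₂} {t : ℝ}
    (hf : ContDiffAt ℝ k f t) (hg : ContDiffAt ℝ k g t) :
    iteratedDeriv k (fun r => (f r, g r)) t = (iteratedDeriv k f t, iteratedDeriv k g t) := by
  simp only [iteratedDeriv, iteratedFDeriv_prodMk hf hg le_rfl, ContinuousMultilinearMap.prod_apply]

theorem iteratedDeriv_two_comp_prodMk_left {F : E₁ × E₂ → ℝ} {ρ : ℝ → E₂} {u : E₁} {t : ℝ}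
    (hF : ContDiffAt ℝ 2 F (u, ρ t)) (hρ : ContDiffAt ℝ 2 ρ t) :
    iteratedDeriv 2 (fun r => F (u, ρ r)) t =
      dirDeriv (0, deriv ρ t) (dirDeriv (0, deriv ρ t) F) (u, ρ t)
        + dirDeriv (0, iteratedDeriv 2 ρ t) F (u, ρ t) := by
  have hρ' := hρ.differentiableAt two_ne_zero
  have hderiv : deriv (fun r => (u, ρ r)) t = (0, deriv ρ t) :=
    ((hasDerivAt_const t u).prodMk hρ'.hasDerivAt).deriv
  have hderiv2 : iteratedDeriv 2 (fun r => (u, ρ r)) t = (0, iteratedDeriv 2 ρ t) := by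
    rw [iteratedDeriv_prodMk contDiffAt_const hρ, iteratedDeriv_const, if_neg two_ne_zero]
  rw [← hderiv, ← hderiv2]
  exact iteratedDeriv_two_comp hF (contDiffAt_const.prodMk hρ)

theorem iteratedDeriv_two_comp_prodMk_right {F : E₁ × E₂ → ℝ} {υ : ℝ → E₁} {w : E₂} {t : ℝ}
    (hF : ContDiffAt ℝ 2 F (υ t, w)) (hυ : ContDiffAt ℝ 2 υ t) :
    iteratedDeriv 2 (fun r => F (υ r, w)) t =
      dirDeriv (deriv υ t, 0) (dirDeriv (deriv υ t, 0) F) (υ t, w)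
        + dirDeriv (iteratedDeriv 2 υ t, 0) F (υ t, w) := by
  have hυ' := hυ.differentiableAt two_ne_zero
  have hderiv : deriv (fun r => (υ r, w)) t = (deriv υ t, 0) :=
    (hυ'.hasDerivAt.prodMk (hasDerivAt_const t w)).deriv
  have hderiv2 : iteratedDeriv 2 (fun r => (υ r, w)) t = (iteratedDeriv 2 υ t, 0) := by
    rw [iteratedDeriv_prodMk hυ contDiffAt_const, iteratedDeriv_const, if_neg two_ne_zero]
  rw [← hderiv, ← hderiv2]
  exact iteratedDeriv_two_comp hF (hυ.prodMk contDiffAt_const)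

theorem iteratedDeriv_two_affine (a b t : ℝ) : iteratedDeriv 2 (fun r => a + r * b) t = 0 := by
  simp [iteratedDeriv_succ', iteratedDeriv_const]

/-- Differentiating `F` twice along each curve produces `∂ₐ²∂_b² F`, the same for both orders, plus
terms in the accelerations; the latter vanish because first derivatives of `F` are affine along the
curves. -/
theorem iteratedDeriv_two_cross_symm {F : E₁ × E₂ → ℝ} {υ : ℝ → E₁} {ρ : ℝ → E₂} {s t : ℝ}
    (hF : ContDiffAt ℝ 4 F (υ s, ρ t)) (hυ : ContDiffAt ℝ 2 υ s) (hρ : ContDiffAt ℝ 2 ρ t)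
    {A B : E₁ → ℝ}
    (hleft : ∀ v, (fun r => dirDeriv (v, 0) F (υ s, ρ r)) =ᶠ[𝓝 t] fun r => A v + r * B v)
    {A' B' : E₂ → ℝ}
    (hright : ∀ w, (fun r => dirDeriv (0, w) F (υ r, ρ t)) =ᶠ[𝓝 s] fun r => A' w + r * B' w) :
    iteratedDeriv 2
        (fun r => dirDeriv (deriv υ s, 0) (dirDeriv (deriv υ s, 0) F) (υ s, ρ r)) t =
      iteratedDeriv 2
        (fun r => dirDeriv (0, deriv ρ t) (dirDeriv (0, deriv ρ t) F) (υ r, ρ t)) s := by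
  have contDiffAt_first : ∀ v, ContDiffAt ℝ 2 (dirDeriv v F) (υ s, ρ t) :=
    contDiffAt_dirDeriv (hF.of_le (by norm_num)) le_rfl
  have contDiffAt_second : ∀ v, ContDiffAt ℝ 2 (dirDeriv v (dirDeriv v F)) (υ s, ρ t) := fun v =>
    contDiffAt_dirDeriv (contDiffAt_dirDeriv (m := 3) hF (by norm_num) v) (by norm_num) v
  have affine_left := (hleft (iteratedDeriv 2 υ s)).iteratedDeriv_eq 2
  rw [iteratedDeriv_two_affine, iteratedDeriv_two_comp_prodMk_left (contDiffAt_first _) hρ]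
    at affine_left
  have affine_right := (hright (iteratedDeriv 2 ρ t)).iteratedDeriv_eq 2
  rw [iteratedDeriv_two_affine, iteratedDeriv_two_comp_prodMk_right (contDiffAt_first _) hυ]
    at affine_right
  rw [iteratedDeriv_two_comp_prodMk_left (contDiffAt_second _) hρ,
    iteratedDeriv_two_comp_prodMk_right (contDiffAt_second _) hυ, dirDeriv_fourth_comm hF,
    dirDeriv_dirDeriv_dirDeriv_comm (hF.of_le (by norm_num)),
    dirDeriv_dirDeriv_dirDeriv_comm (hF.of_le (by norm_num))]
  have mixed_comm := dirDeriv_comm (hF.of_le (by norm_num))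
    (0, iteratedDeriv 2 ρ t) (iteratedDeriv 2 υ s, 0)
  linarith

end ProductCurves

theorem le_add_deriv_of_iteratedDeriv_two_nonpos {f : ℝ → ℝ} {a b : ℝ} (hab : a < b)
    (hf : ∀ t ∈ Icc a b, ContDiffAt ℝ 2 f t) (hf'' : ∀ t ∈ Icc a b, iteratedDeriv 2 f t ≤ 0) :
    f b ≤ f a + deriv f a * (b - a) := by
  have hconcave : ConcaveOn ℝ (Icc a b) f := by
    refine concaveOn_of_deriv2_nonpos' (convex_Icc a b)
      (fun t ht => ((hf t ht).differentiableAt two_ne_zero).differentiableWithinAt)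
      (fun t ht => ?_) fun t ht => by
        simpa only [iteratedDeriv_eq_iterate] using hf'' t ht
    exact (((hf t ht).derivWithin one_add_one_eq_two.le).differentiableAt
      one_ne_zero).differentiableWithinAt
  have hslope := hconcave.slope_le_of_hasDerivAt (left_mem_Icc.2 hab.le) (right_mem_Icc.2 hab.le)
    hab ((hf a (left_mem_Icc.2 hab.le)).differentiableAt two_ne_zero).hasDerivAt
  rw [slope_def_field, div_le_iff₀ (sub_pos.2 hab)] at hslope
  linarith
section SecondOrderQuasiconvexity

theorem nonneg_of_hasDerivAt_ge_neg_abs {u u' : ℝ → ℝ} {a b K : ℝ}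
    (hu : ∀ t ∈ Icc a b, HasDerivAt u (u' t) t) (ha : u a = 0)
    (hK : ∀ t ∈ Icc a b, -(K * |u t|) ≤ u' t) {t : ℝ} (ht : t ∈ Icc a b) : 0 ≤ u t := by
  have barrier : ∀ ε > 0, -u t ≤ ε * Real.exp ((K + 1) * (t - a)) := by
    intro ε hε
    refine image_le_of_deriv_right_lt_deriv_boundary (f := fun t => -u t) (f' := fun t => -u' t)
      (B := fun t => ε * Real.exp ((K + 1) * (t - a)))
      (B' := fun t => ε * (Real.exp ((K + 1) * (t - a)) * ((K + 1) * 1)))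
      (fun r hr => (hu r hr).neg.continuousAt.continuousWithinAt)
      (fun r hr => (hu r (Ico_subset_Icc_self hr)).neg.hasDerivWithinAt)
      (by simp [ha, hε.le])
      (fun r => ((((hasDerivAt_id r).sub_const a).const_mul (K + 1)).exp).const_mul ε) ?_ ht
    intro r hr hrB
    have hpos : 0 < ε * Real.exp ((K + 1) * (r - a)) := by positivity
    have hK := hK r (Ico_subset_Icc_self hr)
    rw [abs_of_neg (by linarith), hrB] at hK
    linarith
  have hlim : Tendsto (fun ε => ε * Real.exp ((K + 1) * (t - a))) (𝓝[>] 0) (𝓝 0) := by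
    refine tendsto_nhdsWithin_of_tendsto_nhds ?_
    simpa using (continuous_mul_const (Real.exp ((K + 1) * (t - a)))).tendsto 0
  linarith [ge_of_tendsto hlim (eventually_mem_nhdsWithin.mono barrier)]

theorem exists_monotoneOn_Icc_of_critical {f f' f'' : ℝ → ℝ} {t K : ℝ}
    (hf : ∀ᶠ r in 𝓝 t, HasDerivAt f (f' r) r) (hf' : ∀ᶠ r in 𝓝 t, HasDerivAt f' (f'' r) r)
    (ht : f' t = 0) (hK : ∀ᶠ r in 𝓝 t, -(K * |f' r|) ≤ f'' r) :
    ∃ ε > 0, MonotoneOn f (Icc t (t + ε)) := by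
  obtain ⟨ε, hε, hball⟩ := Metric.nhds_basis_closedBall.mem_iff.1 (hf.and (hf'.and hK))
  have hnear : ∀ r ∈ Icc t (t + ε), r ∈ Metric.closedBall t ε := fun r hr => by
    rw [Real.closedBall_eq_Icc]
    exact ⟨by linarith [hr.1], hr.2⟩
  have hderiv : ∀ r ∈ Icc t (t + ε), HasDerivAt f (f' r) r := fun r hr => (hball (hnear r hr)).1
  have hnonneg : ∀ r ∈ Icc t (t + ε), 0 ≤ f' r := fun r hr =>
    nonneg_of_hasDerivAt_ge_neg_abs (fun r hr => (hball (hnear r hr)).2.1) ht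
      (fun r hr => (hball (hnear r hr)).2.2) hr
  exact ⟨ε, hε, monotoneOn_of_hasDerivWithinAt_nonneg (convex_Icc _ _)
    (fun r hr => (hderiv r hr).continuousAt.continuousWithinAt)
    (fun r hr => (hderiv r (interior_subset hr)).hasDerivWithinAt)
    (fun r hr => hnonneg r (interior_subset hr))⟩

/-- Past its last interior maximum point, `f` would increase again. -/
theorem le_max_of_second_deriv_ge_neg_abs {f f' f'' : ℝ → ℝ} {a b : ℝ}
    (hf : ∀ t ∈ Icc a b, HasDerivAt f (f' t) t) (hf' : ∀ t ∈ Icc a b, HasDerivAt f' (f'' t) t)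
    (hcrit : ∀ t ∈ Ioo a b, ∃ K, ∀ᶠ r in 𝓝 t, -(K * |f' r|) ≤ f'' r) {t : ℝ}
    (ht : t ∈ Icc a b) : f t ≤ max (f a) (f b) := by
  have hcont : ContinuousOn f (Icc a b) := fun r hr => (hf r hr).continuousAt.continuousWithinAt
  obtain ⟨m, hm, hmax⟩ := isCompact_Icc.exists_isMaxOn ⟨t, ht⟩ hcont
  have hcompact : IsCompact (Icc a b ∩ f ⁻¹' {f m}) :=
    isCompact_Icc.of_isClosed_subset
      (hcont.preimage_isClosed_of_isClosed isClosed_Icc isClosed_singleton) inter_subset_left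
  obtain ⟨l, ⟨hl, hlm : f l = f m⟩, hlast⟩ := hcompact.exists_isGreatest ⟨m, hm, rfl⟩
  refine (hlm ▸ hmax ht : f t ≤ f l).trans (le_max_iff.2 ?_)
  by_contra! hends
  have hl' : l ∈ Ioo a b :=
    ⟨hl.1.lt_of_ne (by rintro rfl; exact hends.1.ne rfl),
      hl.2.lt_of_ne (by rintro rfl; exact hends.2.ne rfl)⟩
  have hIcc : ∀ᶠ r in 𝓝 l, r ∈ Icc a b := Icc_mem_nhds hl'.1 hl'.2
  have hzero : f' l = 0 := by
    refine IsLocalMax.hasDerivAt_eq_zero ?_ (hf l hl)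
    filter_upwards [hIcc] with r hr using hlm ▸ hmax hr
  obtain ⟨K, hK⟩ := hcrit l hl'
  obtain ⟨ε, hε, hmono⟩ := exists_monotoneOn_Icc_of_critical (hIcc.mono hf) (hIcc.mono hf') hzero hK
  obtain ⟨r, hr, hrε⟩ : ∃ r ∈ Icc a b, r ∈ Ioc l (l + ε) :=
    ⟨min b (l + ε), ⟨le_min (hl.1.trans hl.2) (by linarith [hl.1]), min_le_left _ _⟩,
      lt_min hl'.2 (by linarith), min_le_right _ _⟩
  have hrl : f l ≤ f r := hmono ⟨le_rfl, by linarith⟩ (Ioc_subset_Icc_self hrε) hrε.1.le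
  exact hrε.1.not_ge (hlast ⟨hr, le_antisymm (hmax hr) (hlm ▸ hrl)⟩)

variable {V : Type*} [NormedAddCommGroup V] [NormedSpace ℝ V]

theorem exists_hessian_lower_bound {q : ℝ → V →L[ℝ] ℝ} {H : ℝ → V →L[ℝ] V →L[ℝ] ℝ} {t₀ : ℝ}
    (hq : ContinuousAt q t₀) (hH : ContinuousAt H t₀) (hq0 : q t₀ ≠ 0)
    (hker : ∀ᶠ t in 𝓝 t₀, ∀ η, q t η = 0 → 0 ≤ H t η η) (ξ : V) :
    ∃ K : ℝ, ∀ᶠ t in 𝓝 t₀, -(K * |q t ξ|) ≤ H t ξ ξ := by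
  obtain ⟨v, hv⟩ : ∃ v, q t₀ v ≠ 0 := by
    by_contra! hcon
    exact hq0 (ContinuousLinearMap.ext hcon)
  have cont_q : ∀ w, ContinuousAt (fun t => q t w) t₀ := fun w => hq.clm_apply continuousAt_const
  -- split `ξ = η t + μ t • v` with `q t (η t) = 0`; then `H ξ ξ - H η η` is `q t ξ` times `k t`
  let μ : ℝ → ℝ := fun t => q t ξ / q t v
  let η : ℝ → V := fun t => ξ - μ t • v
  let k : ℝ → ℝ := fun t => (H t (η t) v + H t v (η t) + μ t * H t v v) / q t v
  have cont_μ : ContinuousAt μ t₀ := (cont_q ξ).div (cont_q v) hv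
  have cont_η : ContinuousAt η t₀ := continuousAt_const.sub (cont_μ.smul continuousAt_const)
  have cont_k : ContinuousAt k t₀ := by
    have cont_Hv := hH.clm_apply (continuousAt_const (y := v))
    exact ((((hH.clm_apply cont_η).clm_apply continuousAt_const).add
      (cont_Hv.clm_apply cont_η)).add
        (cont_μ.mul (cont_Hv.clm_apply continuousAt_const))).div (cont_q v) hv
  refine ⟨|k t₀| + 1, ?_⟩
  filter_upwards [hker, (cont_q v).eventually_ne hv,
    cont_k.abs.eventually_lt continuousAt_const (lt_add_one |k t₀|)] with t hker hv hk
  have hη : q t (η t) = 0 := by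
    simp only [η, μ, map_sub, map_smul, smul_eq_mul]
    field_simp
    ring
  have hdecomp : H t ξ ξ = H t (η t) (η t) + q t ξ * k t := by
    have hqk : q t ξ * k t = μ t * (H t (η t) v + H t v (η t) + μ t * H t v v) := by
      simp only [k, μ]
      field_simp
    have hξ : ξ = η t + μ t • v := by simp [η]
    rw [hqk]
    conv_lhs => rw [hξ]
    simp only [map_add, map_smul, _root_.add_apply, _root_.smul_apply, smul_eq_mul]
    ring
  have hprod : |q t ξ * k t| ≤ (|k t₀| + 1) * |q t ξ| := by
    rw [abs_mul, mul_comm]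
    gcongr
  linarith [hker _ hη, neg_abs_le (q t ξ * k t)]

theorem quasiconvexOn_of_hessian_nonneg {K : Set V} (hK : Convex ℝ K) {ψ : V → ℝ}
    (hψ : ∀ p ∈ K, ContDiffAt ℝ 2 ψ p) (hgrad : ∀ p ∈ K, fderiv ℝ ψ p ≠ 0)
    (hhess : ∀ p ∈ K, ∀ ξ, fderiv ℝ ψ p ξ = 0 → 0 ≤ fderiv ℝ (fderiv ℝ ψ) p ξ ξ) :
    QuasiconvexOn ℝ K ψ := by
  refine quasiconvexOn_iff_le_max.2 ⟨hK, fun p₀ hp₀ p₁ hp₁ a b ha hb hab => ?_⟩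
  let γ : ℝ → V := AffineMap.lineMap p₀ p₁
  have hγK : ∀ t ∈ Icc (0 : ℝ) 1, γ t ∈ K := fun t ht => hK.lineMap_mem hp₀ hp₁ ht
  have hγ : ∀ t, HasDerivAt γ (p₁ - p₀) t := fun t => AffineMap.hasDerivAt_lineMap
  have hγc : ∀ t, ContinuousAt γ t := fun t => (hγ t).continuousAt
  have hdψ : ∀ p ∈ K, ContDiffAt ℝ 1 (fderiv ℝ ψ) p := fun p hp => (hψ p hp).fderiv_right le_rfl
  have hγb : a • p₀ + b • p₁ = γ b := by
    simp only [γ, AffineMap.lineMap_apply_module, ← hab, add_sub_cancel_right]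
  have hf : ∀ t ∈ Icc (0 : ℝ) 1,
      HasDerivAt (fun r => ψ (γ r)) (fderiv ℝ ψ (γ t) (p₁ - p₀)) t := fun t ht =>
    ((hψ _ (hγK t ht)).differentiableAt two_ne_zero).hasFDerivAt.comp_hasDerivAt t (hγ t)
  have hf' : ∀ t ∈ Icc (0 : ℝ) 1, HasDerivAt (fun r => fderiv ℝ ψ (γ r) (p₁ - p₀))
      (fderiv ℝ (fderiv ℝ ψ) (γ t) (p₁ - p₀) (p₁ - p₀)) t := fun t ht => by
    have hd := ((hdψ _ (hγK t ht)).differentiableAt one_ne_zero).hasFDerivAt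
    simpa using (hd.comp_hasDerivAt t (hγ t)).clm_apply (hasDerivAt_const t (p₁ - p₀))
  have hγ0 : γ 0 = p₀ := AffineMap.lineMap_apply_zero p₀ p₁
  have hγ1 : γ 1 = p₁ := AffineMap.lineMap_apply_one p₀ p₁
  rw [hγb, ← hγ0, ← hγ1]
  refine le_max_of_second_deriv_ge_neg_abs hf hf' (fun t ht => ?_) ⟨hb, by linarith⟩
  have ht' := Ioo_subset_Icc_self ht
  refine exists_hessian_lower_bound (q := fun r => fderiv ℝ ψ (γ r))
    (H := fun r => fderiv ℝ (fderiv ℝ ψ) (γ r)) ((hdψ _ (hγK t ht')).continuousAt.comp (hγc t))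
    (((hdψ _ (hγK t ht')).fderiv_right (m := 0) (by simp)).continuousAt.comp (hγc t))
    (hgrad _ (hγK t ht')) ?_ (p₁ - p₀)
  filter_upwards [Icc_mem_nhds ht.1 ht.2] with r hr using hhess _ (hγK r hr)

end SecondOrderQuasiconvexity

section MetricInChart

variable {n : ℕ} {M : Type*} [TopologicalSpace M] [ChartedSpace (Eu n) M]
  [IsManifold 𝓘(ℝ, Eu n) ∞ M]

theorem contMDiffAt_chart_coordinate_field (x : M) (a : Eu n) :
    ContMDiffAt 𝓘(ℝ, Eu n) 𝓘(ℝ, Eu n).tangent 1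
      (fun u : Eu n => (⟨(extChartAt 𝓘(ℝ, Eu n) x).symm u,
        mfderiv 𝓘(ℝ, Eu n) 𝓘(ℝ, Eu n) (extChartAt 𝓘(ℝ, Eu n) x).symm u a⟩ :
          TangentBundle 𝓘(ℝ, Eu n) M))
      (extChartAt 𝓘(ℝ, Eu n) x x) := by
  have hopen := isOpen_extChartAt_target (I := 𝓘(ℝ, Eu n)) x
  have hmem := mem_extChartAt_target (I := 𝓘(ℝ, Eu n)) x
  have htangent := ((contMDiffOn_extChartAt_symm (n := 2) (I := 𝓘(ℝ, Eu n)) x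
    ).contMDiffOn_tangentMapWithin (m := 1) one_add_one_eq_two.le hopen.uniqueMDiffOn
    ).contMDiffAt (x := ⟨extChartAt 𝓘(ℝ, Eu n) x x, a⟩)
    ((hopen.preimage (FiberBundle.continuous_proj (Eu n) _)).mem_nhds hmem)
  have hconst : ContMDiffAt 𝓘(ℝ, Eu n) 𝓘(ℝ, Eu n).tangent 1
      (fun u : Eu n => (⟨u, a⟩ : TangentBundle 𝓘(ℝ, Eu n) (Eu n)))
      (extChartAt 𝓘(ℝ, Eu n) x x) :=
    contMDiffAt_vectorSpace_iff_contDiffAt.2 contDiffAt_const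
  refine (htangent.comp (extChartAt 𝓘(ℝ, Eu n) x x) hconst).congr_of_eventuallyEq ?_
  filter_upwards [hopen.mem_nhds hmem] with u hu
  simp only [Function.comp_apply, tangentMapWithin, mfderivWithin_of_isOpen hopen hu]

theorem differentiableAt_metricInChart (g : RiemMetric n M) (x : M) (a b : Eu n) :
    DifferentiableAt ℝ (fun u => metricInChart g x u a b) (extChartAt 𝓘(ℝ, Eu n) x x) := by
  have hchart : ContMDiffAt 𝓘(ℝ, Eu n) 𝓘(ℝ, Eu n) 1 (extChartAt 𝓘(ℝ, Eu n) x).symm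
      (extChartAt 𝓘(ℝ, Eu n) x x) :=
    (contMDiffOn_extChartAt_symm x).contMDiffAt (extChartAt_target_mem_nhds x)
  have hmetric := ContMDiffAt.clm_bundle_apply₂ (F₁ := Eu n) (F₂ := Eu n) (F₃ := ℝ)
    (E₁ := fun y : M => TangentSpace 𝓘(ℝ, Eu n) y) (E₂ := fun y : M => TangentSpace 𝓘(ℝ, Eu n) y)
    (E₃ := Bundle.Trivial M ℝ)
    ((g.contMDiff.of_le (by simp)).contMDiffAt.comp (extChartAt 𝓘(ℝ, Eu n) x x) hchart)
    (contMDiffAt_chart_coordinate_field x a) (contMDiffAt_chart_coordinate_field x b)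
  rw [Bundle.contMDiffAt_totalSpace] at hmetric
  exact hmetric.2.contDiffAt.differentiableAt one_ne_zero

theorem metricDeriv_add_left (g : RiemMetric n M) (x : M) (w w' a b : Eu n) :
    metricDeriv g x (w + w') a b = metricDeriv g x w a b + metricDeriv g x w' a b := by
  simp [metricDeriv]

theorem metricDeriv_smul_left (g : RiemMetric n M) (x : M) (w a b : Eu n) (r : ℝ) :
    metricDeriv g x (r • w) a b = r * metricDeriv g x w a b := by
  simp [metricDeriv]

theorem metricDeriv_add_right (g : RiemMetric n M) (x : M) (w a b b' : Eu n) :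
    metricDeriv g x w a (b + b') = metricDeriv g x w a b + metricDeriv g x w a b' := by
  have hadd (u : Eu n) :
      metricInChart g x u a (b + b') = metricInChart g x u a b + metricInChart g x u a b' := by
    unfold metricInChart
    erw [map_add, map_add]
  rw [metricDeriv, funext hadd, fderiv_fun_add (differentiableAt_metricInChart g x a b)
    (differentiableAt_metricInChart g x a b')]
  rfl

theorem metricDeriv_smul_right (g : RiemMetric n M) (x : M) (w a b : Eu n) (r : ℝ) :
    metricDeriv g x w a (r • b) = r * metricDeriv g x w a b := by
  have hsmul (u : Eu n) : metricInChart g x u a (r • b) = r • metricInChart g x u a b := by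
    unfold metricInChart
    erw [map_smul, map_smul]
  rw [metricDeriv, funext hsmul, fderiv_fun_const_smul (differentiableAt_metricInChart g x a b)]
  rfl

/-- The pairing `g(Γ(η, η), q)` of the Christoffel symbol with a vector `q`, by which the Riemannian
Hessian of a function with gradient `q` differs from its second derivative in the chart. -/
noncomputable def christoffelPairing (g : RiemMetric n M) (x : M) (η q : Eu n) : ℝ :=
  (metricDeriv g x η η q + metricDeriv g x η η q - metricDeriv g x q η η) / 2

theorem christoffelPairing_add_smul (g : RiemMetric n M) (x : M) (η p q : Eu n) (t : ℝ) :
    christoffelPairing g x η (p + t • q) =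
      christoffelPairing g x η p + t * christoffelPairing g x η q := by
  simp only [christoffelPairing, metricDeriv_add_left, metricDeriv_add_right,
    metricDeriv_smul_left, metricDeriv_smul_right]
  ring

end MetricInChart

section PartialDerivatives

variable {E₁ E₂ : Type*} [NormedAddCommGroup E₁] [NormedSpace ℝ E₁]
  [NormedAddCommGroup E₂] [NormedSpace ℝ E₂] {C : E₁ × E₂ → ℝ} {u : E₁} {w : E₂}

theorem dirDeriv_comp_swap (C : E₁ × E₂ → ℝ) (v : E₂ × E₁) :
    dirDeriv v (C ∘ Prod.swap) = dirDeriv v.swap C ∘ Prod.swap :=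
  funext fun p => congrArg (· v)
    ((ContinuousLinearEquiv.prodComm ℝ E₂ E₁).comp_right_fderiv (f := C) (x := p))

theorem fderiv_slice_left (hC : DifferentiableAt ℝ C (u, w)) (v : E₁) :
    fderiv ℝ (fun r => C (r, w)) u v = dirDeriv (v, 0) C (u, w) := by
  have h : HasFDerivAt (fun r => C (r, w)) _ u :=
    hC.hasFDerivAt.comp u (hasFDerivAt_prodMk_left u w)
  rw [h.fderiv]
  rfl

theorem fderiv_slice_right (hC : DifferentiableAt ℝ C (u, w)) (v : E₂) :
    fderiv ℝ (fun r => C (u, r)) w v = dirDeriv (0, v) C (u, w) := by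
  have h : HasFDerivAt (fun r => C (u, r)) _ w :=
    hC.hasFDerivAt.comp w (hasFDerivAt_prodMk_right u w)
  rw [h.fderiv]
  rfl

theorem fderiv_fderiv_slice_left (hC : ContDiffAt ℝ 2 C (u, w)) (v v' : E₁) :
    fderiv ℝ (fderiv ℝ fun r => C (r, w)) u v v' =
      dirDeriv (v, 0) (dirDeriv (v', 0) C) (u, w) := by
  have hslice : ContDiffAt ℝ 2 (fun r => C (r, w)) u :=
    hC.comp u (contDiffAt_id.prodMk contDiffAt_const)
  have hfirst : dirDeriv v' (fun r => C (r, w)) =ᶠ[𝓝 u] fun r => dirDeriv (v', 0) C (r, w) := by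
    have hpair : Tendsto (fun r : E₁ => (r, w)) (𝓝 u) (𝓝 (u, w)) :=
      (continuous_id.prodMk continuous_const).continuousAt
    filter_upwards [hpair.eventually (hC.eventually (by simp))] with r hr
    exact fderiv_slice_left (hr.differentiableAt two_ne_zero) v'
  rw [← dirDeriv_dirDeriv_apply hslice, (dirDeriv_eventuallyEq hfirst v).eq_of_nhds]
  exact fderiv_slice_left ((contDiffAt_dirDeriv hC one_add_one_eq_two.le _).differentiableAt
    one_ne_zero) v

/-- The partial differential `∂C/∂u` at `u`, as a map of the second variable. -/
noncomputable def partialLeft (C : E₁ × E₂ → ℝ) (u : E₁) (w : E₂) : E₁ →L[ℝ] ℝ :=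
  (fderiv ℝ C (u, w)).comp (ContinuousLinearMap.inl ℝ E₁ E₂)

theorem contDiffAt_partialLeft {m k : WithTop ℕ∞} (hC : ContDiffAt ℝ k C (u, w))
    (hmk : m + 1 ≤ k) : ContDiffAt ℝ m (partialLeft C u) w :=
  ((hC.fderiv_right hmk).comp w (contDiffAt_const.prodMk contDiffAt_id)).clm_comp contDiffAt_const

theorem fderiv_partialLeft (hC : ContDiffAt ℝ 2 C (u, w)) (w' : E₂) (v : E₁) :
    fderiv ℝ (partialLeft C u) w w' v = dirDeriv (0, w') (dirDeriv (v, 0) C) (u, w) := by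
  have hpartial : DifferentiableAt ℝ (partialLeft C u) w :=
    (contDiffAt_partialLeft hC one_add_one_eq_two.le).differentiableAt one_ne_zero
  rw [← fderiv_slice_right
    ((contDiffAt_dirDeriv hC one_add_one_eq_two.le _).differentiableAt one_ne_zero)]
  change _ = fderiv ℝ (fun r => partialLeft C u r v) w w'
  rw [fderiv_clm_apply hpartial (differentiableAt_const v)]
  simp

variable [FiniteDimensional ℝ E₁] [FiniteDimensional ℝ E₂]

theorem exists_continuousLinearEquiv_of_injective
    (hdim : Module.finrank ℝ E₁ = Module.finrank ℝ E₂) {L : E₂ →L[ℝ] E₁ →L[ℝ] ℝ}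
    (hL : Function.Injective L) :
    ∃ e : E₂ ≃L[ℝ] (E₁ →L[ℝ] ℝ), (e : E₂ →L[ℝ] E₁ →L[ℝ] ℝ) = L := by
  have hdual : Module.finrank ℝ E₂ = Module.finrank ℝ (E₁ →L[ℝ] ℝ) := by
    rw [← (LinearMap.toContinuousLinearMap (𝕜 := ℝ) (E := E₁) (F' := ℝ)).finrank_eq, ← hdim]
    exact Subspace.dual_finrank_eq.symm
  exact ⟨(LinearEquiv.ofInjectiveOfFinrankEq L.toLinearMap hL hdual).toContinuousLinearEquiv,
    ContinuousLinearMap.ext fun _ => rfl⟩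

theorem exists_partialLeft_inverse (hdim : Module.finrank ℝ E₁ = Module.finrank ℝ E₂)
    {k : WithTop ℕ∞} (hC : ContDiffAt ℝ k C (u, w)) {m : WithTop ℕ∞} (hm : 1 ≤ m)
    (hmk : m + 1 ≤ k)
    (hnd : ∀ w', (∀ v, dirDeriv (0, w') (dirDeriv (v, 0) C) (u, w) = 0) → w' = 0) :
    ∃ e : (E₁ →L[ℝ] ℝ) → E₂, ContDiffAt ℝ m e (partialLeft C u w) ∧
      e (partialLeft C u w) = w ∧ Function.Surjective (fderiv ℝ e (partialLeft C u w)) ∧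
      ∀ᶠ p in 𝓝 (partialLeft C u w), partialLeft C u (e p) = p := by
  have hm0 : m ≠ 0 := (zero_lt_one.trans_le hm).ne'
  have hP := contDiffAt_partialLeft hC hmk
  have hC2 : ContDiffAt ℝ 2 C (u, w) :=
    hC.of_le (one_add_one_eq_two.symm.le.trans ((add_le_add_left hm 1).trans hmk))
  obtain ⟨L, hL⟩ := exists_continuousLinearEquiv_of_injective hdim
    ((injective_iff_map_eq_zero (fderiv ℝ (partialLeft C u) w)).2 fun w' hw' => hnd w' fun v => by
      rw [← fderiv_partialLeft hC2, hw', zero_apply])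
  have hderiv : HasFDerivAt (partialLeft C u) (L : E₂ →L[ℝ] E₁ →L[ℝ] ℝ) w := by
    rw [hL]
    exact (hP.differentiableAt hm0).hasFDerivAt
  have hstrict := hP.hasStrictFDerivAt' hderiv hm0
  refine ⟨hP.localInverse hderiv hm0, hP.to_localInverse hderiv hm0,
    hP.localInverse_apply_image hderiv hm0, ?_, hstrict.eventually_right_inverse⟩
  have hinverse : HasFDerivAt (hP.localInverse hderiv hm0)
      (L.symm : (E₁ →L[ℝ] ℝ) →L[ℝ] E₂) (partialLeft C u w) :=
    hstrict.to_localInverse.hasFDerivAt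
  rw [hinverse.fderiv]
  exact L.symm.surjective

end PartialDerivatives

section CostInCharts

variable {n : ℕ} {M N : Type*} [TopologicalSpace M] [ChartedSpace (Eu n) M]
  [TopologicalSpace N] [ChartedSpace (Eu n) N]

local notation "χ" => extChartAt 𝓘(ℝ, Eu n)

theorem costInCharts_swap (c : M → N → ℝ) (x₀ : M) (y₀ : N) :
    costInCharts (n := n) (fun y x => c x y) y₀ x₀ = costInCharts (n := n) c x₀ y₀ ∘ Prod.swap :=
  rfl

/-- The differential of `c(·, y)` at `x`, that is, the covector which the metric identifies with
`∇ₓc(x, y)`. -/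
noncomputable def covec (c : M → N → ℝ) (x : M) (y : N) : Eu n →L[ℝ] ℝ :=
  mfderiv 𝓘(ℝ, Eu n) 𝓘(ℝ, ℝ) (fun z => c z y) x

theorem eventually_mem_target_and_symm_mem {S : Set N} (hS : IsOpen S) {y : N} (hy : y ∈ S) :
    ∀ᶠ w in 𝓝 (χ y y), w ∈ (χ y).target ∧ (χ y).symm w ∈ S := by
  refine Eventually.and (extChartAt_target_mem_nhds y)
    ((continuousAt_extChartAt_symm y).eventually_mem ?_)
  rw [extChartAt_to_inv]
  exact hS.mem_nhds hy

variable [IsManifold 𝓘(ℝ, Eu n) ∞ M]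

theorem mdifferentiableAt_of_chart {f : M → ℝ} {x : M}
    (h : DifferentiableAt ℝ (fun u => f ((χ x).symm u)) (χ x x)) :
    MDifferentiableAt 𝓘(ℝ, Eu n) 𝓘(ℝ, ℝ) f x := by
  refine (h.mdifferentiableAt.comp x
    (mdifferentiableAt_extChartAt (mem_chart_source (Eu n) x))).congr_of_eventuallyEq ?_
  filter_upwards [extChartAt_source_mem_nhds (I := 𝓘(ℝ, Eu n)) x] with z hz
  simp only [Function.comp_apply, (χ x).left_inv hz]

theorem mfderiv_eq_fderiv_chart {f : M → ℝ} {x : M}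
    (h : DifferentiableAt ℝ (fun u => f ((χ x).symm u)) (χ x x)) :
    (mfderiv 𝓘(ℝ, Eu n) 𝓘(ℝ, ℝ) f x : Eu n →L[ℝ] ℝ) =
      fderiv ℝ (fun u => f ((χ x).symm u)) (χ x x) := by
  rw [(mdifferentiableAt_of_chart h).mfderiv]
  simp only [modelWithCornersSelf_coe, range_id, fderivWithin_univ]
  rfl

variable [IsManifold 𝓘(ℝ, Eu n) ∞ N]

theorem contDiffAt_costInCharts {k : WithTop ℕ∞} [ENat.LEInfty k] {c : M → N → ℝ}
    {x₀ x : M} {y₀ y : N}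
    (hc : ContMDiffAt (𝓘(ℝ, Eu n).prod 𝓘(ℝ, Eu n)) 𝓘(ℝ, ℝ) k (fun p : M × N => c p.1 p.2) (x, y))
    (hx : x ∈ (χ x₀).source) (hy : y ∈ (χ y₀).source) :
    ContDiffAt ℝ k (costInCharts (n := n) c x₀ y₀) (χ x₀ x, χ y₀ y) := by
  have hsymm_left : ContMDiffAt 𝓘(ℝ, Eu n) 𝓘(ℝ, Eu n) k (χ x₀).symm (χ x₀ x) :=
    (contMDiffOn_extChartAt_symm x₀).contMDiffAt
      ((isOpen_extChartAt_target x₀).mem_nhds ((χ x₀).map_source hx))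
  have hsymm_right : ContMDiffAt 𝓘(ℝ, Eu n) 𝓘(ℝ, Eu n) k (χ y₀).symm (χ y₀ y) :=
    (contMDiffOn_extChartAt_symm y₀).contMDiffAt
      ((isOpen_extChartAt_target y₀).mem_nhds ((χ y₀).map_source hy))
  have hcomp := ContMDiffAt.comp (χ x₀ x, χ y₀ y)
    (f := Prod.map (χ x₀).symm (χ y₀).symm) (by
      simpa only [Prod.map, (χ x₀).left_inv hx, (χ y₀).left_inv hy] using hc)
    (hsymm_left.prodMap' (p := (χ x₀ x, χ y₀ y)) hsymm_right)
  rw [← modelWithCornersSelf_prod, chartedSpaceSelf_prod] at hcomp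
  exact hcomp.contDiffAt

end CostInCharts

section RegularCosts

/-- A `C⁴` cost, twisted and nondegenerate in both variables, on a pair of open sets each of which
is convex as seen from the other. The hypotheses on gradients are expressed by covectors, so that
no metric is needed and the notion is symmetric in the two variables. -/
structure RegularCost (n : ℕ) {M N : Type*}
    [TopologicalSpace M] [ChartedSpace (Eu n) M] [TopologicalSpace N] [ChartedSpace (Eu n) N]
    (c : M → N → ℝ) (Ω : Set M) (Λ : Set N) : Prop where
  isOpen_left : IsOpen Ω
  isOpen_right : IsOpen Λ
  contMDiffOn : ContMDiffOn (𝓘(ℝ, Eu n).prod 𝓘(ℝ, Eu n)) 𝓘(ℝ, ℝ) 4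
    (fun p : M × N => c p.1 p.2) (Ω ×ˢ Λ)
  injOn_right : ∀ x ∈ Ω, InjOn (covec (n := n) c x) Λ
  injOn_left : ∀ y ∈ Λ, InjOn (covec (n := n) (fun y x => c x y) y) Ω
  nondegenerate_right : ∀ x ∈ Ω, ∀ y ∈ Λ, ∀ w : Eu n,
    (∀ v : Eu n, dirDeriv (0, w) (dirDeriv (v, 0) (costInCharts (n := n) c x y))
      (extChartAt 𝓘(ℝ, Eu n) x x, extChartAt 𝓘(ℝ, Eu n) y y) = 0) → w = 0
  nondegenerate_left : ∀ x ∈ Ω, ∀ y ∈ Λ, ∀ v : Eu n,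
    (∀ w : Eu n, dirDeriv (v, 0) (dirDeriv (0, w) (costInCharts (n := n) c x y))
      (extChartAt 𝓘(ℝ, Eu n) x x, extChartAt 𝓘(ℝ, Eu n) y y) = 0) → v = 0
  convex_right : ∀ x ∈ Ω, Convex ℝ (covec (n := n) c x '' Λ)
  convex_left : ∀ y ∈ Λ, Convex ℝ (covec (n := n) (fun y x => c x y) y '' Ω)

variable {n : ℕ} {M N : Type*} [TopologicalSpace M] [ChartedSpace (Eu n) M]
  [TopologicalSpace N] [ChartedSpace (Eu n) N]

local notation "χ" => extChartAt 𝓘(ℝ, Eu n)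

/-- The counterpart for covectors of the `c`-exponential map: on `{∂ₓc(x, y) | y ∈ Λ}` it is the
inverse of `y ↦ ∂ₓc(x, y)`; off this set its values are irrelevant. -/
noncomputable def dualExp [Nonempty N] (c : M → N → ℝ) (Λ : Set N) (x : M) :
    (Eu n →L[ℝ] ℝ) → N :=
  Function.invFunOn (covec c x) Λ

/-- The `c`-segment with respect to `x` issuing from `y` in the codirection `α`, in the chart
centred at `y`. -/
noncomputable def chartSegment [Nonempty N] (c : M → N → ℝ) (Λ : Set N) (x : M) (y : N)
    (α : Eu n →L[ℝ] ℝ) (t : ℝ) : Eu n :=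
  χ y (dualExp c Λ x (covec c x y + t • α))

/-- The second derivative of `c(·, y)` at `x` in the direction `η`, in the chart centred at `x`. -/
noncomputable def chartHess (c : M → N → ℝ) (x : M) (η : Eu n) (y : N) : ℝ :=
  fderiv ℝ (fderiv ℝ fun u => c ((χ x).symm u) y) (χ x x) η η

variable {c : M → N → ℝ} {Ω : Set M} {Λ : Set N} {x : M} {y : N}

theorem cost_chart_symm_eq {y' : N} (hy' : y' ∈ (χ y).source) :
    (fun u => c ((χ x).symm u) y') = fun u => costInCharts (n := n) c x y (u, χ y y') := by
  simp only [costInCharts, (χ y).left_inv hy']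

namespace RegularCost

theorem swap (H : RegularCost n c Ω Λ) : RegularCost n (fun y x => c x y) Λ Ω where
  isOpen_left := H.isOpen_right
  isOpen_right := H.isOpen_left
  contMDiffOn := H.contMDiffOn.comp (t := Ω ×ˢ Λ) (f := fun p : N × M => (p.2, p.1))
    (contMDiff_snd.prodMk contMDiff_fst).contMDiffOn fun _ hp => ⟨hp.2, hp.1⟩
  injOn_right := H.injOn_left
  injOn_left := H.injOn_right
  nondegenerate_right y hy x hx v hv := H.nondegenerate_left x hx y hy v fun w => by
    simpa only [costInCharts_swap, dirDeriv_comp_swap, Function.comp_apply,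
      Prod.swap_prod_mk] using hv w
  nondegenerate_left y hy x hx w hw := H.nondegenerate_right x hx y hy w fun v => by
    simpa only [costInCharts_swap, dirDeriv_comp_swap, Function.comp_apply,
      Prod.swap_prod_mk] using hw v
  convex_right := H.convex_left
  convex_left := H.convex_right

theorem dualExp_covec [Nonempty N] (H : RegularCost n c Ω Λ) (hx : x ∈ Ω) (hy : y ∈ Λ) :
    dualExp (n := n) c Λ x (covec c x y) = y :=
  (H.injOn_right x hx).leftInvOn_invFunOn hy

theorem chartSegment_zero [Nonempty N] (H : RegularCost n c Ω Λ) (hx : x ∈ Ω) (hy : y ∈ Λ)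
    (α : Eu n →L[ℝ] ℝ) : chartSegment c Λ x y α 0 = χ y y := by
  rw [chartSegment, zero_smul, add_zero, H.dualExp_covec hx hy]

variable [IsManifold 𝓘(ℝ, Eu n) ∞ M] [IsManifold 𝓘(ℝ, Eu n) ∞ N]

theorem contDiffAt_costInCharts (H : RegularCost n c Ω Λ) (hx : x ∈ Ω) {y' : N} (hy : y' ∈ Λ)
    (hys : y' ∈ (χ y).source) :
    ContDiffAt ℝ 4 (costInCharts (n := n) c x y) (χ x x, χ y y') :=
  _root_.contDiffAt_costInCharts
    (H.contMDiffOn.contMDiffAt ((H.isOpen_left.prod H.isOpen_right).mem_nhds ⟨hx, hy⟩))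
    (mem_extChartAt_source x) hys

theorem contDiffAt_chart_left (H : RegularCost n c Ω Λ) (hx : x ∈ Ω) (hy : y ∈ Λ) :
    ContDiffAt ℝ 4 (fun u => c ((χ x).symm u) y) (χ x x) := by
  rw [cost_chart_symm_eq (mem_extChartAt_source y)]
  exact (H.contDiffAt_costInCharts hx hy (mem_extChartAt_source y)).comp (χ x x)
    (contDiffAt_id.prodMk contDiffAt_const)

theorem covec_eq_fderiv_chart (H : RegularCost n c Ω Λ) (hx : x ∈ Ω) (hy : y ∈ Λ) :
    covec c x y = fderiv ℝ (fun u => c ((χ x).symm u) y) (χ x x) :=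
  mfderiv_eq_fderiv_chart ((H.contDiffAt_chart_left hx hy).differentiableAt four_ne_zero)

theorem covec_eq_partialLeft (H : RegularCost n c Ω Λ) (hx : x ∈ Ω) {y' : N} (hy : y' ∈ Λ)
    (hys : y' ∈ (χ y).source) :
    covec c x y' = partialLeft (costInCharts (n := n) c x y) (χ x x) (χ y y') := by
  ext v
  rw [H.covec_eq_fderiv_chart hx hy, cost_chart_symm_eq hys]
  exact fderiv_slice_left
    ((H.contDiffAt_costInCharts hx hy hys).differentiableAt four_ne_zero) v

theorem chartHess_eq (H : RegularCost n c Ω Λ) (hx : x ∈ Ω) {y' : N} (hy : y' ∈ Λ)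
    (hys : y' ∈ (χ y).source) (η : Eu n) :
    chartHess c x η y' =
      dirDeriv (η, 0) (dirDeriv (η, 0) (costInCharts (n := n) c x y)) (χ x x, χ y y') := by
  rw [chartHess, cost_chart_symm_eq hys]
  exact fderiv_fderiv_slice_left
    ((H.contDiffAt_costInCharts hx hy hys).of_le (by norm_num)) η η

variable [Nonempty N]

theorem exists_chart_dualExp (H : RegularCost n c Ω Λ) (hx : x ∈ Ω) (hy : y ∈ Λ) :
    ∃ e : (Eu n →L[ℝ] ℝ) → Eu n, ContDiffAt ℝ 3 e (covec c x y) ∧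
      Function.Surjective (fderiv ℝ e (covec c x y)) ∧
      ∀ᶠ p in 𝓝 (covec c x y), e p ∈ (χ y).target ∧ (χ y).symm (e p) ∈ Λ ∧
        covec c x ((χ y).symm (e p)) = p ∧ dualExp c Λ x p = (χ y).symm (e p) := by
  have hcovec := H.covec_eq_partialLeft hx hy (mem_extChartAt_source y)
  obtain ⟨e, he, hey, hsurj, hinv⟩ := exists_partialLeft_inverse (m := 3) rfl
    (H.contDiffAt_costInCharts hx hy (mem_extChartAt_source y)) (by norm_num) (by norm_num)
    (H.nondegenerate_right x hx y hy)
  rw [← hcovec] at he hey hsurj hinv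
  have hlim : Tendsto e (𝓝 (covec c x y)) (𝓝 (χ y y)) := hey ▸ he.continuousAt
  refine ⟨e, he, hsurj, ?_⟩
  filter_upwards [hlim.eventually (eventually_mem_target_and_symm_mem H.isOpen_right hy), hinv]
    with p ⟨htarget, hmem⟩ hp
  have hright : covec c x ((χ y).symm (e p)) = p := by
    rw [H.covec_eq_partialLeft hx hmem ((χ y).map_target htarget), (χ y).right_inv htarget, hp]
  refine ⟨htarget, hmem, hright, ?_⟩
  rw [← H.dualExp_covec hx hmem, hright]

theorem eventually_dualExp (H : RegularCost n c Ω Λ) (hx : x ∈ Ω) (hy : y ∈ Λ) :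
    ∀ᶠ p in 𝓝 (covec (n := n) c x y), dualExp c Λ x p ∈ Λ ∧ dualExp c Λ x p ∈ (χ y).source ∧
      covec c x (dualExp c Λ x p) = p := by
  obtain ⟨e, -, -, he⟩ := H.exists_chart_dualExp hx hy
  filter_upwards [he] with p ⟨htarget, hmem, hright, hexp⟩
  rw [hexp]
  exact ⟨hmem, (χ y).map_target htarget, hright⟩

theorem contDiffAt_chart_dualExp (H : RegularCost n c Ω Λ) (hx : x ∈ Ω) (hy : y ∈ Λ) :
    ContDiffAt ℝ 3 (fun p => χ y (dualExp (n := n) c Λ x p)) (covec c x y) ∧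
      Function.Surjective (fderiv ℝ (fun p => χ y (dualExp (n := n) c Λ x p)) (covec c x y)) := by
  obtain ⟨e, he, hsurj, hev⟩ := H.exists_chart_dualExp hx hy
  have heq : (fun p => χ y (dualExp (n := n) c Λ x p)) =ᶠ[𝓝 (covec (n := n) c x y)] e := by
    filter_upwards [hev] with p ⟨htarget, _, _, hexp⟩
    rw [hexp, (χ y).right_inv htarget]
  exact ⟨he.congr_of_eventuallyEq heq, heq.fderiv_eq (𝕜 := ℝ) ▸ hsurj⟩

theorem contDiffAt_cost_dualExp (H : RegularCost n c Ω Λ) (hx : x ∈ Ω) (hy : y ∈ Λ) {z : M}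
    (hz : z ∈ Ω) : ContDiffAt ℝ 3 (fun p => c z (dualExp (n := n) c Λ x p)) (covec c x y) ∧
      ∀ ξ, fderiv ℝ (fun p => c z (dualExp (n := n) c Λ x p)) (covec c x y) ξ =
        covec (n := n) (fun y x => c x y) y z
          (fderiv ℝ (fun p => χ y (dualExp c Λ x p)) (covec c x y) ξ) := by
  have hbase : χ y (dualExp (n := n) c Λ x (covec c x y)) = χ y y := by
    rw [H.dualExp_covec hx hy]
  have hcost : ContDiffAt ℝ 4 (fun w => c z ((χ y).symm w)) (χ y y) :=
    H.swap.contDiffAt_chart_left hy hz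
  have hexp := (H.contDiffAt_chart_dualExp hx hy).1
  have heq : (fun p => c z (dualExp (n := n) c Λ x p)) =ᶠ[𝓝 (covec c x y)]
      (fun w => c z ((χ y).symm w)) ∘ fun p => χ y (dualExp c Λ x p) := by
    filter_upwards [H.eventually_dualExp hx hy] with p ⟨_, hsource, _⟩
    simp only [Function.comp_apply, (χ y).left_inv hsource]
  rw [← hbase] at hcost
  have hcost3 : ContDiffAt ℝ 3 (fun w => c z ((χ y).symm w)) _ := hcost.of_le (by norm_num)
  refine ⟨(hcost3.comp (covec (n := n) c x y) hexp).congr_of_eventuallyEq heq, fun ξ => ?_⟩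
  rw [heq.fderiv_eq, fderiv_comp (covec (n := n) c x y) (hcost3.differentiableAt three_ne_zero)
    (hexp.differentiableAt three_ne_zero), hbase, H.swap.covec_eq_fderiv_chart hy hz]
  rfl

end RegularCost

end RegularCosts

section CrossCurvature

variable {n : ℕ} {M N : Type*} [TopologicalSpace M] [ChartedSpace (Eu n) M]
  [TopologicalSpace N] [ChartedSpace (Eu n) N]

local notation "χ" => extChartAt 𝓘(ℝ, Eu n)

/-- The coordinate form of the curvature condition **A3W** at `(x, y)`: along `c`-segments through
`y`, the Hessian of the cost in `x` is concave at `y` in every direction `η` which annihilates the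
codirection of the segment. -/
def CrossConcaveAt [Nonempty N] (c : M → N → ℝ) (Λ : Set N) (x : M) (y : N) : Prop :=
  ∀ (η : Eu n) (α : Eu n →L[ℝ] ℝ), α η = 0 →
    iteratedDeriv 2 (fun t : ℝ => chartHess c x η (dualExp c Λ x (covec c x y + t • α))) 0 ≤ 0

variable [IsManifold 𝓘(ℝ, Eu n) ∞ M] [IsManifold 𝓘(ℝ, Eu n) ∞ N] [Nonempty N]
  {c : M → N → ℝ} {Ω : Set M} {Λ : Set N} {x : M} {y : N}

namespace RegularCost

theorem eventually_dualExp_add_smul (H : RegularCost n c Ω Λ) (hx : x ∈ Ω) (hy : y ∈ Λ)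
    (α : Eu n →L[ℝ] ℝ) :
    ∀ᶠ t : ℝ in 𝓝 0, dualExp c Λ x (covec c x y + t • α) ∈ Λ ∧
      dualExp c Λ x (covec c x y + t • α) ∈ (χ y).source ∧
      covec c x (dualExp c Λ x (covec c x y + t • α)) = covec c x y + t • α := by
  have hline : Tendsto (fun t : ℝ => covec c x y + t • α) (𝓝 0) (𝓝 (covec c x y)) :=
    Continuous.tendsto' (by fun_prop) _ _ (by simp)
  exact hline.eventually (H.eventually_dualExp hx hy)

theorem contDiffAt_chartSegment (H : RegularCost n c Ω Λ) (hx : x ∈ Ω) (hy : y ∈ Λ)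
    (α : Eu n →L[ℝ] ℝ) : ContDiffAt ℝ 3 (chartSegment c Λ x y α) 0 :=
  ContDiffAt.comp (f := fun t : ℝ => covec c x y + t • α) 0
    (by simpa using (H.contDiffAt_chart_dualExp hx hy).1) (by fun_prop)

theorem deriv_chartSegment (H : RegularCost n c Ω Λ) (hx : x ∈ Ω) (hy : y ∈ Λ)
    (α : Eu n →L[ℝ] ℝ) : deriv (chartSegment c Λ x y α) 0 =
      fderiv ℝ (fun p => χ y (dualExp (n := n) c Λ x p)) (covec c x y) α := by
  have hexp := ((H.contDiffAt_chart_dualExp hx hy).1.differentiableAt three_ne_zero).hasFDerivAt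
  have hline : HasDerivAt (fun t : ℝ => covec c x y + t • α) α 0 := by
    simpa using ((hasDerivAt_id (0 : ℝ)).smul_const α).const_add (covec c x y)
  exact (hexp.comp_hasDerivAt_of_eq 0 hline (by simp)).deriv

theorem exists_deriv_chartSegment_eq (H : RegularCost n c Ω Λ) (hx : x ∈ Ω) (hy : y ∈ Λ)
    (w : Eu n) : ∃ α, deriv (chartSegment c Λ x y α) 0 = w := by
  obtain ⟨α, hα⟩ := (H.contDiffAt_chart_dualExp hx hy).2 w
  exact ⟨α, by rw [H.deriv_chartSegment hx hy, hα]⟩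

theorem eventually_dirDeriv_chartSegment (H : RegularCost n c Ω Λ) (hx : x ∈ Ω) (hy : y ∈ Λ)
    (α : Eu n →L[ℝ] ℝ) (v : Eu n) :
    (fun t => dirDeriv (v, 0) (costInCharts (n := n) c x y) (χ x x, chartSegment c Λ x y α t))
      =ᶠ[𝓝 0] fun t => covec c x y v + t * α v := by
  filter_upwards [H.eventually_dualExp_add_smul hx hy α] with t ⟨hmem, hsource, hcovec⟩
  exact congrArg (· v) ((H.covec_eq_partialLeft hx hmem hsource).symm.trans hcovec)

theorem chartHess_dualExp_eventuallyEq (H : RegularCost n c Ω Λ) (hx : x ∈ Ω) (hy : y ∈ Λ)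
    (α : Eu n →L[ℝ] ℝ) (η : Eu n) :
    (fun t : ℝ => chartHess c x η (dualExp c Λ x (covec c x y + t • α))) =ᶠ[𝓝 0] fun t =>
      dirDeriv (η, 0) (dirDeriv (η, 0) (costInCharts (n := n) c x y))
        (χ x x, chartSegment c Λ x y α t) := by
  filter_upwards [H.eventually_dualExp_add_smul hx hy α] with t ⟨hmem, hsource, _⟩
  exact H.chartHess_eq hx hmem hsource η

theorem contDiffAt_chartHess_dualExp (H : RegularCost n c Ω Λ) (hx : x ∈ Ω) (hy : y ∈ Λ)
    (η : Eu n) :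
    ContDiffAt ℝ 2 (fun p => chartHess c x η (dualExp (n := n) c Λ x p)) (covec c x y) := by
  have hC := H.contDiffAt_costInCharts hx hy (mem_extChartAt_source y)
  have hCηη : ContDiffAt ℝ 2 (dirDeriv (η, 0) (dirDeriv (η, 0) (costInCharts (n := n) c x y)))
      (χ x x, χ y y) :=
    contDiffAt_dirDeriv (contDiffAt_dirDeriv (m := 3) hC (by norm_num) _) (by norm_num) _
  have heq : (fun p => chartHess c x η (dualExp (n := n) c Λ x p)) =ᶠ[𝓝 (covec c x y)] fun p =>
      dirDeriv (η, 0) (dirDeriv (η, 0) (costInCharts (n := n) c x y))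
        (χ x x, χ y (dualExp c Λ x p)) := by
    filter_upwards [H.eventually_dualExp hx hy] with p ⟨hmem, hsource, _⟩
    exact H.chartHess_eq hx hmem hsource η
  have hbase : χ y (dualExp (n := n) c Λ x (covec c x y)) = χ y y := by
    rw [H.dualExp_covec hx hy]
  exact (ContDiffAt.comp (g := dirDeriv (η, 0) (dirDeriv (η, 0) (costInCharts (n := n) c x y)))
    (f := fun p => (χ x x, χ y (dualExp (n := n) c Λ x p))) (covec (n := n) c x y)
    (by rw [hbase]; exact hCηη) (contDiffAt_const.prodMk
      ((H.contDiffAt_chart_dualExp hx hy).1.of_le (by norm_num)))).congr_of_eventuallyEq heq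

theorem dirDeriv_deriv_chartSegment (H : RegularCost n c Ω Λ) (hx : x ∈ Ω) (hy : y ∈ Λ)
    (α : Eu n →L[ℝ] ℝ) (v : Eu n) :
    dirDeriv (0, deriv (chartSegment c Λ x y α) 0)
      (dirDeriv (v, 0) (costInCharts (n := n) c x y)) (χ x x, χ y y) = α v := by
  have hC := H.contDiffAt_costInCharts hx hy (mem_extChartAt_source y)
  have hCv := (contDiffAt_dirDeriv (m := 3) hC (by norm_num) (v, 0)).differentiableAt three_ne_zero
  have hρ := ((H.contDiffAt_chartSegment hx hy α).differentiableAt three_ne_zero).hasDerivAt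
  have hcomp := hCv.hasFDerivAt.comp_hasDerivAt_of_eq 0 ((hasDerivAt_const 0 (χ x x)).prodMk hρ)
    (by rw [H.chartSegment_zero hx hy])
  have haffine : HasDerivAt (fun t => covec c x y v + t * α v) (α v) 0 := by
    simpa using ((hasDerivAt_id (0 : ℝ)).mul_const (α v)).const_add (covec c x y v)
  exact hcomp.unique
    (haffine.congr_of_eventuallyEq (H.eventually_dirDeriv_chartSegment hx hy α v))

variable [Nonempty M]

theorem codirection_symm (H : RegularCost n c Ω Λ) (hx : x ∈ Ω) (hy : y ∈ Λ)
    (α β : Eu n →L[ℝ] ℝ) : α (deriv (chartSegment (fun y x => c x y) Ω y x β) 0) =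
      β (deriv (chartSegment c Λ x y α) 0) := by
  have hC := H.contDiffAt_costInCharts hx hy (mem_extChartAt_source y)
  rw [← H.dirDeriv_deriv_chartSegment hx hy α, ← H.swap.dirDeriv_deriv_chartSegment hy hx β]
  simp only [costInCharts_swap, dirDeriv_comp_swap, Function.comp_apply, Prod.swap_prod_mk]
  exact dirDeriv_comm (hC.of_le (by norm_num)) _ _

omit [Nonempty N] in
theorem eventually_dirDeriv_chartSegment_swap (H : RegularCost n c Ω Λ) (hx : x ∈ Ω) (hy : y ∈ Λ)
    (β : Eu n →L[ℝ] ℝ) (w : Eu n) :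
    (fun s => dirDeriv (0, w) (costInCharts (n := n) c x y)
      (chartSegment (fun y x => c x y) Ω y x β s, χ y y))
      =ᶠ[𝓝 0] fun s => covec (fun y x => c x y) y x w + s * β w := by
  have h := H.swap.eventually_dirDeriv_chartSegment hy hx β w
  rw [costInCharts_swap, dirDeriv_comp_swap] at h
  exact h

theorem crossConcaveAt_swap (H : RegularCost n c Ω Λ) (hx : x ∈ Ω) (hy : y ∈ Λ)
    (hcurv : CrossConcaveAt (n := n) c Λ x y) :
    CrossConcaveAt (n := n) (fun y x => c x y) Ω y x := by
  intro w β hβw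
  obtain ⟨α, hα⟩ := H.exists_deriv_chartSegment_eq hx hy w
  obtain ⟨η, hη⟩ : ∃ η, deriv (chartSegment (fun y x => c x y) Ω y x β) 0 = η := ⟨_, rfl⟩
  have hυ0 := H.swap.chartSegment_zero hy hx β
  have hρ0 := H.chartSegment_zero hx hy α
  have hαη : α η = 0 := by rw [← hη, H.codirection_symm hx hy, hα, hβw]
  have hcross := iteratedDeriv_two_cross_symm (F := costInCharts (n := n) c x y)
    (υ := chartSegment (fun y x => c x y) Ω y x β) (ρ := chartSegment c Λ x y α) (s := 0) (t := 0)
    (by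
      rw [hυ0, hρ0]
      exact H.contDiffAt_costInCharts hx hy (mem_extChartAt_source y))
    ((H.swap.contDiffAt_chartSegment hy hx β).of_le (by norm_num))
    ((H.contDiffAt_chartSegment hx hy α).of_le (by norm_num))
    (by
      rw [hυ0]
      exact H.eventually_dirDeriv_chartSegment hx hy α)
    (by
      rw [hρ0]
      exact H.eventually_dirDeriv_chartSegment_swap hx hy β)
  rw [hα, hη, hυ0, hρ0] at hcross
  calc iteratedDeriv 2 (fun s : ℝ => chartHess (fun y x => c x y) y w
        (dualExp (fun y x => c x y) Ω y (covec (fun y x => c x y) y x + s • β))) 0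
      = iteratedDeriv 2 (fun s => dirDeriv (0, w) (dirDeriv (0, w) (costInCharts (n := n) c x y))
          (chartSegment (fun y x => c x y) Ω y x β s, χ y y)) 0 := by
        rw [(H.swap.chartHess_dualExp_eventuallyEq hy hx β w).iteratedDeriv_eq 2]
        simp only [costInCharts_swap, dirDeriv_comp_swap]
        rfl
    _ = iteratedDeriv 2 (fun t : ℝ => chartHess c x η (dualExp c Λ x (covec c x y + t • α))) 0 := by
        rw [← hcross, (H.chartHess_dualExp_eventuallyEq hx hy α η).iteratedDeriv_eq 2]
    _ ≤ 0 := hcurv η α hαη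

end RegularCost

end CrossCurvature

section MaximumPrinciple

variable {n : ℕ} {M N : Type*} [TopologicalSpace M] [ChartedSpace (Eu n) M]
  [TopologicalSpace N] [ChartedSpace (Eu n) N]
  [IsManifold 𝓘(ℝ, Eu n) ∞ M] [IsManifold 𝓘(ℝ, Eu n) ∞ N]
  [Nonempty M] {c : M → N → ℝ} {Ω : Set M} {Λ : Set N} {x : M} {y : N}

local notation "χ" => extChartAt 𝓘(ℝ, Eu n)

namespace RegularCost

theorem iteratedDeriv_two_cost_dualExp (H : RegularCost n c Ω Λ) (hx : x ∈ Ω) {y₀ y : N}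
    (hy₀ : y₀ ∈ Λ) (hy : y ∈ Λ) (β : Eu n →L[ℝ] ℝ) :
    iteratedDeriv 2 (fun s : ℝ => c (dualExp (fun y x => c x y) Ω y₀
        (covec (fun y x => c x y) y₀ x + s • β)) y) 0 =
      chartHess c x (deriv (chartSegment (fun y x => c x y) Ω y₀ x β) 0) y
        + covec c x y (iteratedDeriv 2 (chartSegment (fun y x => c x y) Ω y₀ x β) 0) := by
  have hcost := (H.contDiffAt_chart_left hx hy).of_le (m := 2) (by norm_num)
  have hυ0 := H.swap.chartSegment_zero hy₀ hx β
  have heq : (fun s : ℝ => c (dualExp (fun y x => c x y) Ω y₀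
      (covec (fun y x => c x y) y₀ x + s • β)) y) =ᶠ[𝓝 0]
        fun s => c ((χ x).symm (chartSegment (fun y x => c x y) Ω y₀ x β s)) y := by
    filter_upwards [H.swap.eventually_dualExp_add_smul hy₀ hx β] with s ⟨_, hsource, _⟩
    rw [chartSegment, (χ x).left_inv hsource]
  rw [heq.iteratedDeriv_eq 2,
    iteratedDeriv_two_comp (F := fun u => c ((χ x).symm u) y) (hυ0 ▸ hcost)
      ((H.swap.contDiffAt_chartSegment hy₀ hx β).of_le (by norm_num)),
    hυ0, dirDeriv_dirDeriv_apply hcost, H.covec_eq_fderiv_chart hx hy]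
  rfl

variable [Nonempty N]

/-- Along `υ` the differential of `C` in the second variable is affine; the mixed derivative of this
relation trades the acceleration of `υ` for a derivative of the Hessian. -/
theorem deriv_chartHess_dualExp (H : RegularCost n c Ω Λ) (hx : x ∈ Ω) (hy : y ∈ Λ)
    (α β : Eu n →L[ℝ] ℝ) :
    deriv (fun t : ℝ => chartHess c x (deriv (chartSegment (fun y x => c x y) Ω y x β) 0)
        (dualExp c Λ x (covec c x y + t • α))) 0 =
      -α (iteratedDeriv 2 (chartSegment (fun y x => c x y) Ω y x β) 0) := by
  have hC := H.contDiffAt_costInCharts hx hy (mem_extChartAt_source y)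
  have hυ0 := H.swap.chartSegment_zero hy hx β
  have hυ := (H.swap.contDiffAt_chartSegment hy hx β).of_le (m := 2) (by norm_num)
  have hρ := ((H.contDiffAt_chartSegment hx hy α).differentiableAt three_ne_zero).hasDerivAt
  have hacc := H.dirDeriv_deriv_chartSegment hx hy α
    (iteratedDeriv 2 (chartSegment (fun y x => c x y) Ω y x β) 0)
  set w := deriv (chartSegment c Λ x y α) 0
  have haffine := (H.eventually_dirDeriv_chartSegment_swap hx hy β w).iteratedDeriv_eq 2
  rw [iteratedDeriv_two_affine, iteratedDeriv_two_comp_prodMk_right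
    (contDiffAt_dirDeriv (m := 2) (by rw [hυ0]; exact hC) (by norm_num) _) hυ, hυ0,
    ← dirDeriv_dirDeriv_dirDeriv_comm (hC.of_le (by norm_num)),
    dirDeriv_comm (hC.of_le (by norm_num)), hacc] at haffine
  set η := deriv (chartSegment (fun y x => c x y) Ω y x β) 0
  have hCηη : ContDiffAt ℝ 2 (dirDeriv (η, 0) (dirDeriv (η, 0) (costInCharts (n := n) c x y)))
      (χ x x, χ y y) :=
    contDiffAt_dirDeriv (contDiffAt_dirDeriv (m := 3) hC (by norm_num) _) (by norm_num) _
  have hcomp := (hCηη.differentiableAt two_ne_zero).hasFDerivAt.comp_hasDerivAt_of_eq 0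
    ((hasDerivAt_const 0 (χ x x)).prodMk hρ) (by rw [H.chartSegment_zero hx hy])
  rw [(H.chartHess_dualExp_eventuallyEq hx hy α η).deriv_eq]
  exact hcomp.deriv.trans (eq_neg_of_add_eq_zero_left haffine)

omit [Nonempty M] in
theorem chartHess_le (H : RegularCost n c Ω Λ) (hx : x ∈ Ω)
    (hcurv : ∀ y ∈ Λ, CrossConcaveAt (n := n) c Λ x y) {y₀ y₁ : N} (hy₀ : y₀ ∈ Λ) (hy₁ : y₁ ∈ Λ)
    {η : Eu n} (hη : covec c x y₁ η = covec c x y₀ η) :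
    chartHess c x η y₁ ≤ chartHess c x η y₀ + deriv (fun t : ℝ => chartHess c x η
      (dualExp (n := n) c Λ x (covec c x y₀ + t • (covec c x y₁ - covec c x y₀)))) 0 := by
  set α := covec (n := n) c x y₁ - covec c x y₀ with hα
  have hαη : α η = 0 := by rw [hα, sub_apply, hη, sub_self]
  have hsegment : ∀ t ∈ Icc (0 : ℝ) 1, ∃ y ∈ Λ,
      covec (n := n) c x y = covec c x y₀ + t • α :=
    fun t ht => (H.convex_right x hx).add_smul_sub_mem (mem_image_of_mem _ hy₀)
      (mem_image_of_mem _ hy₁) ht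
  have hle := le_add_deriv_of_iteratedDeriv_two_nonpos zero_lt_one
    (f := fun t : ℝ => chartHess c x η (dualExp (n := n) c Λ x (covec c x y₀ + t • α)))
    (fun t ht => by
      obtain ⟨y, hy, hyt⟩ := hsegment t ht
      exact ContDiffAt.comp (f := fun t : ℝ => covec c x y₀ + t • α) t
        (hyt ▸ H.contDiffAt_chartHess_dualExp hx hy η) (by fun_prop))
    (fun t ht => by
      obtain ⟨y, hy, hyt⟩ := hsegment t ht
      have hconcave := hcurv y hy η α hαη
      simp only [hyt, add_assoc, ← add_smul] at hconcave
      rw [iteratedDeriv_comp_const_add 2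
        (fun t : ℝ => chartHess c x η (dualExp c Λ x (covec c x y₀ + t • α)))] at hconcave
      simpa only [add_zero] using hconcave)
  simpa only [zero_smul, one_smul, add_zero, hα, add_sub_cancel, sub_zero, mul_one,
    H.dualExp_covec hx hy₀, H.dualExp_covec hx hy₁] using hle

theorem iteratedDeriv_two_cost_le (H : RegularCost n c Ω Λ) (hx : x ∈ Ω)
    (hcurv : ∀ y ∈ Λ, CrossConcaveAt (n := n) c Λ x y) {y₀ y₁ : N} (hy₀ : y₀ ∈ Λ) (hy₁ : y₁ ∈ Λ)
    {β : Eu n →L[ℝ] ℝ}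
    (hcrit : covec c x y₁ (deriv (chartSegment (fun y x => c x y) Ω y₀ x β) 0) =
      covec c x y₀ (deriv (chartSegment (fun y x => c x y) Ω y₀ x β) 0)) :
    iteratedDeriv 2 (fun s : ℝ => c (dualExp (fun y x => c x y) Ω y₀
        (covec (fun y x => c x y) y₀ x + s • β)) y₁) 0 ≤
      iteratedDeriv 2 (fun s : ℝ => c (dualExp (fun y x => c x y) Ω y₀
        (covec (fun y x => c x y) y₀ x + s • β)) y₀) 0 := by
  rw [H.iteratedDeriv_two_cost_dualExp hx hy₀ hy₁, H.iteratedDeriv_two_cost_dualExp hx hy₀ hy₀]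
  have hle := H.chartHess_le hx hcurv hy₀ hy₁ hcrit
  rw [H.deriv_chartHess_dualExp hx hy₀, sub_apply] at hle
  linarith

omit [Nonempty M] in
theorem contDiffAt_cost_sub_cost (H : RegularCost n c Ω Λ) (hx : x ∈ Ω) (hy : y ∈ Λ) {z : M}
    (hz : z ∈ Ω) : ContDiffAt ℝ 2
      (fun p => c x (dualExp (n := n) c Λ x p) - c z (dualExp c Λ x p)) (covec c x y) :=
  ((H.contDiffAt_cost_dualExp hx hy hx).1.sub (H.contDiffAt_cost_dualExp hx hy hz).1).of_le
    (by norm_num)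

omit [Nonempty M] in
theorem fderiv_cost_sub_cost (H : RegularCost n c Ω Λ) (hx : x ∈ Ω) (hy : y ∈ Λ) {z : M}
    (hz : z ∈ Ω) (ξ : Eu n →L[ℝ] ℝ) :
    fderiv ℝ (fun p => c x (dualExp (n := n) c Λ x p) - c z (dualExp c Λ x p)) (covec c x y) ξ =
      covec (fun y x => c x y) y x (deriv (chartSegment c Λ x y ξ) 0) -
        covec (fun y x => c x y) y z (deriv (chartSegment c Λ x y ξ) 0) := by
  obtain ⟨hsmooth_x, hfderiv_x⟩ := H.contDiffAt_cost_dualExp hx hy hx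
  obtain ⟨hsmooth_z, hfderiv_z⟩ := H.contDiffAt_cost_dualExp hx hy hz
  rw [fderiv_fun_sub (hsmooth_x.differentiableAt three_ne_zero)
    (hsmooth_z.differentiableAt three_ne_zero), sub_apply, hfderiv_x, hfderiv_z,
    H.deriv_chartSegment hx hy]

omit [Nonempty M] in
theorem fderiv_fderiv_cost_sub_cost (H : RegularCost n c Ω Λ) (hx : x ∈ Ω) (hy : y ∈ Λ)
    {z : M} (hz : z ∈ Ω) (ξ : Eu n →L[ℝ] ℝ) :
    fderiv ℝ (fderiv ℝ fun p => c x (dualExp (n := n) c Λ x p) - c z (dualExp c Λ x p))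
        (covec c x y) ξ ξ =
      iteratedDeriv 2 (fun t : ℝ => c x (dualExp c Λ x (covec c x y + t • ξ))) 0 -
        iteratedDeriv 2 (fun t : ℝ => c z (dualExp c Λ x (covec c x y + t • ξ))) 0 := by
  have hsmooth {z : M} (hz : z ∈ Ω) :
      ContDiffAt ℝ 2 (fun t : ℝ => c z (dualExp c Λ x (covec c x y + t • ξ))) 0 :=
    ContDiffAt.comp (g := fun p => c z (dualExp (n := n) c Λ x p))
      (f := fun t : ℝ => covec c x y + t • ξ) 0
      (by simpa using (H.contDiffAt_cost_dualExp hx hy hz).1.of_le (by norm_num)) (by fun_prop)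
  rw [← iteratedDeriv_two_comp_add_smul (H.contDiffAt_cost_sub_cost hx hy hz),
    iteratedDeriv_fun_sub (hsmooth hx) (hsmooth hz)]

theorem quasiconvexOn_cost_sub_cost (H : RegularCost n c Ω Λ)
    (hcurv : ∀ x ∈ Ω, ∀ y ∈ Λ, CrossConcaveAt (n := n) c Λ x y) (hx : x ∈ Ω) {z : M} (hz : z ∈ Ω) :
    QuasiconvexOn ℝ (covec (n := n) c x '' Λ)
      fun p => c x (dualExp (n := n) c Λ x p) - c z (dualExp c Λ x p) := by
  obtain rfl | hxz := eq_or_ne x z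
  · simpa only [sub_self] using (convexOn_const (0 : ℝ) (H.convex_right x hx)).quasiconvexOn
  refine quasiconvexOn_of_hessian_nonneg (H.convex_right x hx) ?_ ?_ ?_
  · rintro _ ⟨y, hy, rfl⟩
    exact H.contDiffAt_cost_sub_cost hx hy hz
  · rintro _ ⟨y, hy, rfl⟩ hzero
    refine hxz (H.injOn_left y hy hx hz (ContinuousLinearMap.ext fun w => ?_))
    obtain ⟨ξ, rfl⟩ := H.exists_deriv_chartSegment_eq hx hy w
    rw [← sub_eq_zero, ← H.fderiv_cost_sub_cost hx hy hz, hzero, zero_apply]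
  · rintro _ ⟨y, hy, rfl⟩ ξ hξ
    rw [H.fderiv_cost_sub_cost hx hy hz, sub_eq_zero] at hξ
    rw [H.fderiv_fderiv_cost_sub_cost hx hy hz, sub_nonneg]
    exact H.swap.iteratedDeriv_two_cost_le hy
      (fun x hx => H.crossConcaveAt_swap hx hy (hcurv x hx y hy)) hx hz hξ.symm

end RegularCost

end MaximumPrinciple

section Riemannian

theorem invFunOn_comp_of_injective {α β γ : Type*} [Nonempty α] {e : β → γ}
    (he : Function.Injective e) (f : α → β) (s : Set α) (b : β) :
    Function.invFunOn (fun a => e (f a)) s (e b) = Function.invFunOn f s b := by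
  unfold Function.invFunOn
  congr! 5
  all_goals simp only [he.eq_iff]

variable {n : ℕ} {M N : Type*} [TopologicalSpace M] [ChartedSpace (Eu n) M]
  [IsManifold 𝓘(ℝ, Eu n) ∞ M]

theorem riemMetric_inner_self_nonneg (g : RiemMetric n M) (x : M)
    (v : TangentSpace 𝓘(ℝ, Eu n) x) : 0 ≤ g.inner x v v := by
  obtain rfl | hv := eq_or_ne v 0
  · simp only [map_zero, le_refl]
  · exact (g.pos x v hv).le

theorem exists_flat_equiv (g : RiemMetric n M) (x : M) :
    ∃ e : Eu n ≃L[ℝ] (Eu n →L[ℝ] ℝ), ∀ v w : Eu n, e v w = g.inner x v w := by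
  obtain ⟨e, he⟩ := exists_continuousLinearEquiv_of_injective (E₁ := Eu n) (E₂ := Eu n) rfl
    (L := g.inner x) ((injective_iff_map_eq_zero _).2 fun v hv => by
      by_contra hne
      exact (g.pos x v hne).ne' (congrArg (· v) hv))
  exact ⟨e, fun v w => congrArg (fun L : Eu n →L[ℝ] Eu n →L[ℝ] ℝ => L v w) he⟩

/-- The isomorphism `v ↦ -g_x(v, ·)` from vectors to covectors, in coordinates; it maps
`-∇ₓc(x, y)` to the differential of `c(·, y)` at `x`. -/
noncomputable def negFlat (g : RiemMetric n M) (x : M) : Eu n ≃L[ℝ] (Eu n →L[ℝ] ℝ) :=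
  (ContinuousLinearEquiv.neg ℝ).trans (exists_flat_equiv g x).choose

theorem negFlat_apply (g : RiemMetric n M) (x : M) (v w : Eu n) :
    negFlat g x v w = -g.inner x v w := by
  rw [← (exists_flat_equiv g x).choose_spec]
  simp [negFlat]

/-- `-∇ₓc(x, y)` as an element of the model space, which is the carrier of `T_xM`. -/
noncomputable def negGradCoord (g : RiemMetric n M) (c : M → N → ℝ) (x : M) (y : N) : Eu n :=
  negGrad g c x y

theorem negFlat_negGradCoord (g : RiemMetric n M) (c : M → N → ℝ) (x : M) (y : N) :
    negFlat g x (negGradCoord g c x y) = covec c x y := by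
  ext w
  rw [negFlat_apply]
  change -g.inner x (-riemGrad g (fun z => c z y) x) w = _
  rw [map_neg]
  exact (neg_neg _).trans (inner_riemGrad g (fun z => c z y) x w)

theorem isCConvexAt_iff_convex_covec (g : RiemMetric n M) (c : M → N → ℝ) (S : Set N) (x : M) :
    IsCConvexAt g c S x ↔ Convex ℝ (covec (n := n) c x '' S) := by
  have himage : covec (n := n) c x '' S = negFlat g x '' (negGradCoord g c x '' S) := by
    simp only [image_image, negFlat_negGradCoord]
  change Convex ℝ (negGradCoord g c x '' S) ↔ _
  rw [himage]
  refine ⟨fun h => h.linear_image (negFlat g x).toLinearMap, fun h => ?_⟩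
  rw [← preimage_image_eq (negGradCoord g c x '' S) (negFlat g x).injective]
  exact h.linear_preimage (negFlat g x).toLinearMap

variable {c : M → N → ℝ} {Ω : Set M} {Λ : Set N} {x : M} {y : N}

theorem injOn_covec_of_injOn_negGrad (g : RiemMetric n M) {S : Set N}
    (h : InjOn (fun y => negGrad g c x y) S) : InjOn (covec (n := n) c x) S := by
  intro y hy y' hy' hyy'
  rw [← negFlat_negGradCoord g, ← negFlat_negGradCoord g] at hyy'
  exact h hy hy' ((negFlat g x).injective hyy')

theorem cExp_eq_dualExp [Nonempty N] (g : RiemMetric n M) (c : M → N → ℝ) (Λ : Set N) (y : N)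
    (x : M) (p : Eu n) : cExp g c Λ y x p = dualExp c Λ x (negFlat g x p) := by
  rw [dualExp, funext fun y' => (negFlat_negGradCoord g c x y').symm,
    invFunOn_comp_of_injective (negFlat g x).injective]
  rfl

theorem riemHess_eq_chartHess_sub (g : RiemMetric n M) (c : M → N → ℝ) (x : M) (η : Eu n) (y : N) :
    riemHess g (fun z => c z y) x η η =
      chartHess c x η y - christoffelPairing g x η (-(negFlat g x).symm (covec c x y)) := by
  have hgrad : -(negFlat g x).symm (covec c x y) = riemGrad g (fun z => c z y) x := by
    rw [← negFlat_negGradCoord g, ContinuousLinearEquiv.symm_apply_apply]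
    exact neg_neg _
  rw [hgrad]
  rfl

variable [TopologicalSpace N] [ChartedSpace (Eu n) N] [IsManifold 𝓘(ℝ, Eu n) ∞ N] [Nonempty N]

namespace RegularCost

/-- Along a `c`-segment the gradient is affine, so the Riemannian Hessian of the cost differs from
its second derivative in a chart by an affine function. -/
theorem cSectional_eq_neg (g : RiemMetric n M) (H : RegularCost n c Ω Λ) (hx : x ∈ Ω) (hy : y ∈ Λ)
    (η ξ : Eu n) : cSectional g c Λ x y η ξ = -iteratedDeriv 2
      (fun t : ℝ => chartHess c x η (dualExp c Λ x (covec c x y + t • negFlat g x ξ))) 0 := by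
  set q := (negFlat g x).symm (covec c x y)
  set a := christoffelPairing g x η (-q)
  set b := christoffelPairing g x η (-ξ)
  have hline (t : ℝ) : cExp g c Λ y x (negGradCoord g c x y + t • ξ) =
      dualExp c Λ x (covec c x y + t • negFlat g x ξ) := by
    rw [cExp_eq_dualExp, map_add, map_smul, negFlat_negGradCoord]
  have heq : (fun t : ℝ => -riemHess g
      (fun z => c z (cExp g c Λ y x (negGradCoord g c x y + t • ξ))) x η η) =ᶠ[𝓝 0]
      fun t =>
        -chartHess c x η (dualExp c Λ x (covec c x y + t • negFlat g x ξ)) + (a + t * b) := by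
    filter_upwards [H.eventually_dualExp_add_smul hx hy (negFlat g x ξ)] with t ⟨_, _, hcovec⟩
    rw [hline, riemHess_eq_chartHess_sub, hcovec, map_add, map_smul,
      ContinuousLinearEquiv.symm_apply_apply, neg_add, ← smul_neg, christoffelPairing_add_smul]
    ring
  have hsmooth : ContDiffAt ℝ 2
      (fun t : ℝ => chartHess c x η (dualExp c Λ x (covec c x y + t • negFlat g x ξ))) 0 :=
    ContDiffAt.comp (g := fun p => chartHess c x η (dualExp (n := n) c Λ x p))
      (f := fun t : ℝ => covec c x y + t • negFlat g x ξ) 0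
      (by simpa using H.contDiffAt_chartHess_dualExp hx hy η) (by fun_prop)
  refine (heq.iteratedDeriv_eq 2).trans ?_
  rw [iteratedDeriv_fun_add hsmooth.neg (by fun_prop), iteratedDeriv_fun_neg,
    iteratedDeriv_two_affine, add_zero]

theorem crossConcaveAt (g : RiemMetric n M) (H : RegularCost n c Ω Λ) (hA3 : CostA3W g c Ω Λ)
    (hx : x ∈ Ω) (hy : y ∈ Λ) : CrossConcaveAt (n := n) c Λ x y := by
  intro η α hαη
  obtain ⟨C₀, hC₀, hA3⟩ := hA3
  obtain ⟨ξ, rfl⟩ := (negFlat g x).surjective α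
  have horthogonal : g.inner x η ξ = 0 := by
    rw [negFlat_apply, neg_eq_zero] at hαη
    exact (g.symm x η ξ).trans hαη
  have hnonneg : 0 ≤ cSectional g c Λ x y η ξ :=
    (mul_nonneg (mul_nonneg hC₀ (riemMetric_inner_self_nonneg g x η))
      (riemMetric_inner_self_nonneg g x ξ)).trans (hA3 x hx y hy η ξ horthogonal)
  rwa [H.cSectional_eq_neg g hx hy, neg_nonneg] at hnonneg

end RegularCost

end Riemannian

section MixedHessian

variable {n : ℕ} {A : Matrix (Fin n) (Fin n) ℝ}

local notation "χ" => extChartAt 𝓘(ℝ, Eu n)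

/-- The bilinear form `(w, v) ↦ ∑ᵢⱼ Aᵢⱼ vᵢ wⱼ` of a matrix. -/
noncomputable def matrixForm (A : Matrix (Fin n) (Fin n) ℝ) : Eu n →L[ℝ] Eu n →L[ℝ] ℝ :=
  (innerSL ℝ).comp (Matrix.toEuclideanCLM (𝕜 := ℝ) A)

open Matrix in
theorem matrixForm_apply (A : Matrix (Fin n) (Fin n) ℝ) (w v : Eu n) :
    matrixForm A w v = v.ofLp ⬝ᵥ A *ᵥ w.ofLp := by
  simp [matrixForm, EuclideanSpace.inner_eq_star_dotProduct]

theorem eq_matrixForm (B : Eu n →L[ℝ] Eu n →L[ℝ] ℝ) :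
    B = matrixForm (Matrix.of fun i j =>
      B (EuclideanSpace.single j 1) (EuclideanSpace.single i 1)) := by
  refine ContinuousLinearMap.coe_injective ((EuclideanSpace.basisFun (Fin n) ℝ).toBasis.ext
    fun j => ContinuousLinearMap.coe_injective
      ((EuclideanSpace.basisFun (Fin n) ℝ).toBasis.ext fun i => ?_))
  simp [matrixForm_apply]

theorem eq_zero_of_matrixForm_right (hA : A.det ≠ 0) {w : Eu n}
    (h : ∀ v, matrixForm A w v = 0) : w = 0 := by
  refine WithLp.ofLp_injective 2 (Matrix.eq_zero_of_mulVec_eq_zero hA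
    (dotProduct_eq_zero _ fun v => ?_))
  rw [dotProduct_comm, ← matrixForm_apply A w (WithLp.toLp 2 v), h]

theorem eq_zero_of_matrixForm_left (hA : A.det ≠ 0) {v : Eu n}
    (h : ∀ w, matrixForm A w v = 0) : v = 0 := by
  refine WithLp.ofLp_injective 2 (Matrix.eq_zero_of_vecMul_eq_zero hA
    (dotProduct_eq_zero _ fun w => ?_))
  rw [← Matrix.dotProduct_mulVec, ← matrixForm_apply A (WithLp.toLp 2 w), h]

variable {M N : Type*}
  [TopologicalSpace M] [ChartedSpace (Eu n) M] [TopologicalSpace N] [ChartedSpace (Eu n) N]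
  {c : M → N → ℝ} {Ω : Set M} {Λ : Set N} {x x₀ : M} {y y₀ : N}

theorem fderiv_partialLeft_eq_matrixForm
    (hC : ContDiffAt ℝ 2 (costInCharts (n := n) c x₀ y₀) (χ x₀ x, χ y₀ y)) :
    fderiv ℝ (partialLeft (costInCharts (n := n) c x₀ y₀) (χ x₀ x)) (χ y₀ y) =
      matrixForm (mixedHess c x₀ y₀ x y) := by
  rw [eq_matrixForm (fderiv ℝ _ _)]
  congr 1
  ext i j
  have hslice : ∀ᶠ w in 𝓝 (χ y₀ y),
      dirDeriv (EuclideanSpace.single i 1, 0) (costInCharts c x₀ y₀) (χ x₀ x, w) =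
        fderiv ℝ (fun u => costInCharts c x₀ y₀ (u, w)) (χ x₀ x) (EuclideanSpace.single i 1) := by
    have hpair : Tendsto (fun w : Eu n => (χ x₀ x, w)) (𝓝 (χ y₀ y)) (𝓝 (χ x₀ x, χ y₀ y)) :=
      (Continuous.prodMk_right _).continuousAt
    filter_upwards [hpair.eventually (hC.eventually (by simp))] with w hw
    exact (fderiv_slice_left (hw.differentiableAt two_ne_zero) _).symm
  rw [Matrix.of_apply, mixedHess, Matrix.of_apply, fderiv_partialLeft hC]
  refine (fderiv_slice_right ((contDiffAt_dirDeriv hC one_add_one_eq_two.le _).differentiableAt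
    one_ne_zero) _).symm.trans ?_
  exact congrArg (· (EuclideanSpace.single j 1)) (EventuallyEq.fderiv_eq (𝕜 := ℝ) hslice)

theorem det_mixedHess_ne_zero (hΩ : IsOpen Ω) (hΛ : IsOpen Λ) (hA2 : CostA2 (n := n) c Ω Λ)
    (hx : x ∈ Ω) (hy : y ∈ Λ) : (mixedHess (n := n) c x y x y).det ≠ 0 := by
  obtain ⟨A, hA, hlim⟩ := hA2 x (subset_closure hx) y (subset_closure hy)
  rw [(hΩ.prod hΛ).nhdsWithin_eq ⟨hx, hy⟩] at hlim
  exact eq_of_tendsto_nhds hlim ▸ hA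

variable [IsManifold 𝓘(ℝ, Eu n) ∞ M] [IsManifold 𝓘(ℝ, Eu n) ∞ N]

theorem regularCost_of_hypotheses (g : RiemMetric n M) (h : RiemMetric n N)
    (hΩ : IsOpen Ω) (hΛ : IsOpen Λ)
    (hA0 : CostA0 (n := n) c Ω Λ) (hA1 : CostA1 g h c Ω Λ) (hA2 : CostA2 (n := n) c Ω Λ)
    (hcΛ : ∀ x ∈ Ω, IsCConvexAt g c Λ x)
    (hcΩ : ∀ y ∈ Λ, IsCConvexAt h (fun y x => c x y) Ω y) : RegularCost n c Ω Λ := by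
  have hC (x) (hx : x ∈ Ω) (y) (hy : y ∈ Λ) :
      ContDiffAt ℝ 2 (costInCharts (n := n) c x y) (χ x x, χ y y) :=
    (contDiffAt_costInCharts (hA0.contMDiffOn.contMDiffAt ((hΩ.prod hΛ).mem_nhds ⟨hx, hy⟩))
      (mem_extChartAt_source x) (mem_extChartAt_source y)).of_le (by norm_num)
  have hform (x) (hx : x ∈ Ω) (y) (hy : y ∈ Λ) (v w : Eu n) :
      dirDeriv (0, w) (dirDeriv (v, 0) (costInCharts (n := n) c x y)) (χ x x, χ y y) =
        matrixForm (mixedHess c x y x y) w v := by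
    rw [← fderiv_partialLeft_eq_matrixForm (hC x hx y hy), fderiv_partialLeft (hC x hx y hy)]
  exact {
    isOpen_left := hΩ
    isOpen_right := hΛ
    contMDiffOn := hA0.contMDiffOn
    injOn_right := fun x hx =>
      (injOn_covec_of_injOn_negGrad g (hA1.1 x hx)).mono subset_closure
    injOn_left := fun y hy =>
      (injOn_covec_of_injOn_negGrad h (hA1.2 y hy)).mono subset_closure
    nondegenerate_right := fun x hx y hy w hw =>
      eq_zero_of_matrixForm_right (det_mixedHess_ne_zero hΩ hΛ hA2 hx hy) fun v =>
        (hform x hx y hy v w).symm.trans (hw v)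
    nondegenerate_left := fun x hx y hy v hv =>
      eq_zero_of_matrixForm_left (det_mixedHess_ne_zero hΩ hΛ hA2 hx hy) fun w =>
        (hform x hx y hy v w).symm.trans ((dirDeriv_comm (hC x hx y hy) _ _).trans (hv w))
    convex_right := fun x hx => (isCConvexAt_iff_convex_covec g c Λ x).1 (hcΛ x hx)
    convex_left := fun y hy =>
      (isCConvexAt_iff_convex_covec h (fun y x => c x y) Ω y).1 (hcΩ y hy) }

end MixedHessian

section ContactSet

variable {X Y : Type*} [TopologicalSpace Y] {c : X → Y → ℝ} {Ω : Set X} {Λ : Set Y} {φ : X → ℝ}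
  {x : X}

theorem mem_contactSet_iff (hx : x ∈ Ω) {y : Y} :
    y ∈ contactSet c Ω Λ φ x ↔ y ∈ closure Λ ∧ ∀ z ∈ Ω, c x y - c z y ≤ φ z - φ x := by
  refine and_congr_right fun _ => ?_
  set s : EReal := ⨆ z ∈ Ω, ((-c z y - φ z : ℝ) : EReal)
  have hx_le : ((-c x y - φ x : ℝ) : EReal) ≤ s :=
    le_iSup₂ (f := fun z (_ : z ∈ Ω) => ((-c z y - φ z : ℝ) : EReal)) x hx
  calc (φ x : EReal) + s = ((-c x y : ℝ) : EReal)
    _ ↔ s ≤ ((-c x y - φ x : ℝ) : EReal) := by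
      refine ⟨fun h => ?_, fun h => ?_⟩
      · rw [EReal.coe_sub, ← h, EReal.add_sub_cancel_left]
      · rw [h.antisymm hx_le, ← EReal.coe_add, add_sub_cancel]
    _ ↔ ∀ z ∈ Ω, c x y - c z y ≤ φ z - φ x := by
      refine iSup₂_le_iff.trans (forall₂_congr fun z _ => ?_)
      rw [EReal.coe_le_coe_iff]
      constructor <;> intro h <;> linarith

theorem contactSet_nonempty (hφ : IsCConvexFunction c Ω Λ φ) (hx : x ∈ Ω) :
    (contactSet c Ω Λ φ x).Nonempty := by
  obtain ⟨v, hv, -, hsup, hattained⟩ := hφ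
  obtain ⟨y, hy, hxy⟩ := hattained x hx
  refine ⟨y, (mem_contactSet_iff hx).2 ⟨hy, fun z hz => ?_⟩⟩
  have hz_le : ((-c z y : ℝ) : EReal) - v y ≤ φ z := by
    rw [hsup z hz]
    exact le_iSup₂ (f := fun y (_ : y ∈ closure Λ) => ((-c z y : ℝ) : EReal) - v y) y hy
  have hbot := hv y hy
  generalize v y = r at *
  induction r with
  | bot => exact absurd rfl hbot
  | top => exact absurd ((EReal.coe_add_top _).symm.trans hxy).symm (EReal.coe_ne_top _)
  | coe r =>
    rw [← EReal.coe_add, EReal.coe_eq_coe_iff] at hxy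
    rw [← EReal.coe_sub, EReal.coe_le_coe_iff] at hz_le
    linarith

theorem convex_image_contactSet {V : Type*} [AddCommGroup V] [Module ℝ V] {F : Y → V} {E : V → Y}
    {S : Set Y} (hx : x ∈ Ω) (hGS : contactSet c Ω Λ φ x ⊆ S) (hSΛ : S ⊆ closure Λ)
    (hE : LeftInvOn E F S)
    (hquasi : ∀ z ∈ Ω, QuasiconvexOn ℝ (F '' S) fun p => c x (E p) - c z (E p)) :
    Convex ℝ (F '' contactSet c Ω Λ φ x) := by
  have himage : F '' contactSet c Ω Λ φ x =
      F '' S ∩ ⋂ z ∈ Ω, {p ∈ F '' S | c x (E p) - c z (E p) ≤ φ z - φ x} := by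
    ext p
    simp only [mem_inter_iff, mem_iInter, mem_sep_iff]
    constructor
    · rintro ⟨y, hy, rfl⟩
      have hyS := mem_image_of_mem F (hGS hy)
      refine ⟨hyS, fun z hz => ⟨hyS, ?_⟩⟩
      rw [hE (hGS hy)]
      exact ((mem_contactSet_iff hx).1 hy).2 z hz
    · rintro ⟨⟨y, hy, rfl⟩, hall⟩
      simp only [hE hy] at hall
      exact ⟨y, (mem_contactSet_iff hx).2 ⟨hSΛ hy, fun z hz => (hall z hz).2⟩, rfl⟩
  rw [himage]
  exact (hquasi x hx).convex.inter (convex_iInter₂ fun z hz => hquasi z hz _)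

end ContactSet

section Closure

theorem continuousOn_closure_of_tendsto {X Y : Type*} [TopologicalSpace X] [TopologicalSpace Y]
    [T3Space Y] {f : X → Y} {A : Set X}
    (h : ∀ x ∈ closure A, Tendsto f (𝓝[A] x) (𝓝 (f x))) : ContinuousOn f (closure A) :=
  (continuousOn_extendFrom Subset.rfl fun x hx => ⟨f x, h x hx⟩).congr fun x hx =>
    (extendFrom_eq hx (h x hx)).symm

theorem mem_closure_inter_preimage {X Y : Type*} [TopologicalSpace X] [TopologicalSpace Y]
    {f : X → Y} {A : Set X} {U : Set Y} {x : X} (hx : x ∈ closure A)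
    (hf : ContinuousWithinAt f A x) (hU : U ∈ 𝓝 (f x)) : x ∈ closure (A ∩ f ⁻¹' U) := by
  rw [inter_comm, mem_closure_iff_nhdsWithin_neBot, nhdsWithin_inter_of_mem (hf hU)]
  exact mem_closure_iff_nhdsWithin_neBot.1 hx

/-- The image under `E` of a small ball about `F x₀` is connected, comes close to `x₀`, and misses
the frontier of a given small neighbourhood of `x₀` by injectivity of `F`; so it stays inside. -/
theorem continuousOn_leftInverse_closure {X V : Type*} [TopologicalSpace X] [T2Space X]
    [LocallyCompactSpace X] [NormedAddCommGroup V] [NormedSpace ℝ V] {A : Set X} {F : X → V}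
    {E : V → X} (hF : ContinuousOn F (closure A)) (hconv : Convex ℝ (F '' A))
    (hE : LeftInvOn E F (closure A)) (hEc : ContinuousOn E (F '' A)) :
    ContinuousOn E (F '' closure A) := by
  rintro _ ⟨x₀, hx₀, rfl⟩
  rw [ContinuousWithinAt, hE hx₀]
  refine (compact_basis_nhds x₀).tendsto_right_iff.2 fun K ⟨hK, hKc⟩ => ?_
  have hfrontier : IsClosed (F '' (closure A ∩ (K \ interior K))) :=
    (((hKc.diff isOpen_interior).inter_left isClosed_closure).image_of_continuousOn
      (hF.mono inter_subset_left)).isClosed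
  have hx₀F : F x₀ ∉ F '' (closure A ∩ (K \ interior K)) := by
    rintro ⟨x, ⟨hxA, -, hxK⟩, hxx₀⟩
    exact hxK (hE.injOn hxA hx₀ hxx₀ ▸ mem_interior_iff_mem_nhds.2 hK)
  obtain ⟨r, hr, hball⟩ := Metric.isOpen_iff.1 hfrontier.isOpen_compl _ hx₀F
  have hconn : IsPreconnected (A ∩ F ⁻¹' Metric.ball (F x₀) r) := by
    rw [← (hE.mono (inter_subset_left.trans subset_closure)).image_image, image_inter_preimage]
    exact (hconv.inter (convex_ball _ _)).isPreconnected.image E (hEc.mono inter_subset_left)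
  have hclosure {x} (hx : x ∈ closure A) (hxr : F x ∈ Metric.ball (F x₀) r) :
      x ∈ closure (A ∩ F ⁻¹' Metric.ball (F x₀) r) :=
    mem_closure_inter_preimage hx ((hF x hx).mono subset_closure)
      (Metric.isOpen_ball.mem_nhds hxr)
  have hsub : A ∩ F ⁻¹' Metric.ball (F x₀) r ⊆ interior K := by
    refine hconn.subset_left_of_subset_union isOpen_interior hKc.isClosed.isOpen_compl
      (disjoint_compl_right.mono_left interior_subset) (fun x ⟨hx, hxr⟩ => ?_) ?_
    · by_contra hxK
      simp only [mem_union, mem_compl_iff, not_or, not_not] at hxK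
      exact hball hxr ⟨x, ⟨subset_closure hx, hxK.2, hxK.1⟩, rfl⟩
    · rw [inter_comm]
      exact mem_closure_iff_nhds.1 (hclosure hx₀ (Metric.mem_ball_self hr)) _
        (interior_mem_nhds.2 hK)
  filter_upwards [self_mem_nhdsWithin, mem_nhdsWithin_of_mem_nhds (Metric.ball_mem_nhds _ hr)]
  rintro _ ⟨x, hx, rfl⟩ hxr
  rw [hE hx]
  exact closure_minimal (hsub.trans interior_subset) hKc.isClosed (hclosure hx hxr)

theorem quasiconvexOn_of_dense {V : Type*} [AddCommGroup V] [Module ℝ V] [TopologicalSpace V]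
    [ContinuousAdd V] [ContinuousConstSMul ℝ V] {K L : Set V} {f : V → ℝ}
    (hf : QuasiconvexOn ℝ K f) (hKL : K ⊆ L) (hLK : L ⊆ closure K)
    (hL : Convex ℝ L) (hc : ContinuousOn f L) : QuasiconvexOn ℝ L f := by
  rw [quasiconvexOn_iff_le_max] at hf ⊢
  refine ⟨hL, fun p hp q hq a b ha hb hab => ?_⟩
  have : NeBot (𝓝[K] p) := mem_closure_iff_nhdsWithin_neBot.1 (hLK hp)
  have : NeBot (𝓝[K] q) := mem_closure_iff_nhdsWithin_neBot.1 (hLK hq)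
  have hlim (r) (hr : r ∈ L) : Tendsto f (𝓝[K] r) (𝓝 (f r)) := (hc r hr).mono hKL
  have hmem : ∀ᶠ z in 𝓝[K] p ×ˢ 𝓝[K] q, z.1 ∈ K ∧ z.2 ∈ K :=
    (eventually_mem_nhdsWithin (a := p)).prod_mk (eventually_mem_nhdsWithin (a := q))
  have hcomb : Tendsto (fun z : V × V => a • z.1 + b • z.2) (𝓝[K] p ×ˢ 𝓝[K] q)
      (𝓝[K] (a • p + b • q)) := by
    refine tendsto_nhdsWithin_iff.2 ⟨?_, hmem.mono fun z hz => hf.1 hz.1 hz.2 ha hb hab⟩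
    exact ((tendsto_fst.mono_right nhdsWithin_le_nhds).const_smul a).add
      ((tendsto_snd.mono_right nhdsWithin_le_nhds).const_smul b)
  exact le_of_tendsto_of_tendsto ((hlim _ (hL hp hq ha hb hab)).comp hcomb)
    (((hlim p hp).comp tendsto_fst).max ((hlim q hq).comp tendsto_snd))
    (hmem.mono fun z hz => hf.2 hz.1 hz.2 ha hb hab)

end Closure

section Boundary

variable {n : ℕ} {M N : Type*}
  [TopologicalSpace M] [ChartedSpace (Eu n) M] [TopologicalSpace N] [ChartedSpace (Eu n) N]
  {c : M → N → ℝ} {Ω : Set M} {Λ : Set N} {x : M}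

local notation "χ" => extChartAt 𝓘(ℝ, Eu n)

theorem tendsto_prodMk_nhdsWithin_prod {X Y : Type*} [TopologicalSpace X] [TopologicalSpace Y]
    {A : Set X} {B : Set Y} {a : X} (ha : a ∈ A) (b : Y) :
    Tendsto (Prod.mk a) (𝓝[B] b) (𝓝[A ×ˢ B] (a, b)) :=
  nhdsWithin_prod_eq a b A B ▸ (tendsto_nhdsWithin_iff.2
    ⟨tendsto_const_nhds, Eventually.of_forall fun _ => ha⟩).prodMk tendsto_id

theorem continuousOn_cost_closure (hA0 : CostA0 (n := n) c Ω Λ) (hx : x ∈ Ω) :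
    ContinuousOn (c x) (closure Λ) :=
  continuousOn_closure_of_tendsto fun y hy => (hA0.tendsto x (subset_closure hx) y hy).comp
    (tendsto_prodMk_nhdsWithin_prod hx y)

theorem exists_tendsto_partialLeft (hΩ : IsOpen Ω) (hA0 : CostA0 (n := n) c Ω Λ) (hx : x ∈ Ω)
    {y₀ : N} (hy₀ : y₀ ∈ closure Λ) : ∃ L : Eu n →L[ℝ] ℝ, Tendsto
      (fun q : N × Eu n => partialLeft (costInCharts (n := n) c x y₀) q.2 (χ y₀ q.1))
      (𝓝[Λ] y₀ ×ˢ 𝓝 (χ x x)) (𝓝 L) := by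
  obtain ⟨L, hL⟩ := hA0.tendsto_deriv x (subset_closure hx) y₀ hy₀ 1 (by norm_num)
  have hsymm : Tendsto (χ x).symm (𝓝 (χ x x)) (𝓝[Ω] x) := by
    rw [hΩ.nhdsWithin_eq hx]
    simpa only [extChartAt_to_inv] using (continuousAt_extChartAt_symm (I := 𝓘(ℝ, Eu n)) x).tendsto
  have hpair : Tendsto (fun q : N × Eu n => ((χ x).symm q.2, q.1))
      (𝓝[Λ] y₀ ×ˢ 𝓝 (χ x x)) (𝓝[Ω ×ˢ Λ] (x, y₀)) :=
    nhdsWithin_prod_eq x y₀ Ω Λ ▸ (hsymm.comp tendsto_snd).prodMk tendsto_fst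
  have hrestrict : Continuous fun T : (Eu n × Eu n) [×1]→L[ℝ] ℝ =>
      (continuousMultilinearCurryFin1 ℝ (Eu n × Eu n) ℝ T).comp
        (ContinuousLinearMap.inl ℝ (Eu n) (Eu n)) := by
    fun_prop
  refine ⟨_, ((hrestrict.tendsto L).comp (hL.comp hpair)).congr' ?_⟩
  filter_upwards [tendsto_snd.eventually (extChartAt_target_mem_nhds (I := 𝓘(ℝ, Eu n)) x)]
    with q hq
  have hright : χ x ((χ x).symm q.2) = q.2 := (χ x).right_inv hq
  ext v
  simp only [Function.comp_apply, hright]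
  simp [partialLeft, iteratedFDeriv_one_apply]

variable [IsManifold 𝓘(ℝ, Eu n) ∞ M] [IsManifold 𝓘(ℝ, Eu n) ∞ N]

theorem eventually_hasFDerivAt_cost (hΩ : IsOpen Ω) (hΛ : IsOpen Λ) (hA0 : CostA0 (n := n) c Ω Λ)
    (hx : x ∈ Ω) (y₀ : N) : ∀ᶠ q : N × Eu n in 𝓝[Λ] y₀ ×ˢ 𝓝 (χ x x),
      HasFDerivAt (fun u => c ((χ x).symm u) q.1)
        (partialLeft (costInCharts (n := n) c x y₀) q.2 (χ y₀ q.1)) q.2 := by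
  filter_upwards [tendsto_fst.eventually self_mem_nhdsWithin,
    tendsto_fst.eventually
      (mem_nhdsWithin_of_mem_nhds (extChartAt_source_mem_nhds (I := 𝓘(ℝ, Eu n)) y₀)),
    tendsto_snd.eventually (eventually_mem_target_and_symm_mem hΩ hx)]
    with ⟨y, u⟩ hy hys ⟨hu, huΩ⟩
  have hC : ContDiffAt ℝ 4 (costInCharts (n := n) c x y₀) (u, χ y₀ y) := by
    have hC' := contDiffAt_costInCharts
      (hA0.contMDiffOn.contMDiffAt ((hΩ.prod hΛ).mem_nhds ⟨huΩ, hy⟩)) ((χ x).map_target hu) hys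
    rwa [(χ x).right_inv hu] at hC'
  rw [cost_chart_symm_eq hys]
  exact (hC.differentiableAt four_ne_zero).hasFDerivAt.comp (f := fun u => (u, χ y₀ y)) u
    (hasFDerivAt_prodMk_left u (χ y₀ y))

/-- The differential of `c(·, y₀)` exists even at boundary points `y₀`: there `c(·, y₀)` is a limit
of functions whose differentials converge uniformly. -/
theorem tendsto_covec (hΩ : IsOpen Ω) (hΛ : IsOpen Λ) (hA0 : CostA0 (n := n) c Ω Λ)
    (hx : x ∈ Ω) {y₀ : N} (hy₀ : y₀ ∈ closure Λ) :
    Tendsto (covec (n := n) c x) (𝓝[Λ] y₀) (𝓝 (covec c x y₀)) := by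
  have : NeBot (𝓝[Λ] y₀) := mem_closure_iff_nhdsWithin_neBot.1 hy₀
  obtain ⟨L, hL⟩ := exists_tendsto_partialLeft hΩ hA0 hx hy₀
  have hderiv := eventually_hasFDerivAt_cost hΩ hΛ hA0 hx y₀
  have hlim : ∀ᶠ u in 𝓝 (χ x x),
      Tendsto (fun y => c ((χ x).symm u) y) (𝓝[Λ] y₀) (𝓝 (c ((χ x).symm u) y₀)) := by
    filter_upwards [eventually_mem_target_and_symm_mem hΩ hx] with u ⟨_, hu⟩
    exact (continuousOn_cost_closure hA0 hu y₀ hy₀).mono subset_closure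
  have hL₀ : HasFDerivAt (fun u => c ((χ x).symm u) y₀) L (χ x x) :=
    hasFDerivAt_of_tendstoUniformlyOnFilter (g' := fun _ => L)
      (f' := fun y u => partialLeft (costInCharts (n := n) c x y₀) u (χ y₀ y))
      (tendstoUniformlyOnFilter_iff_tendsto.2 (Uniform.tendsto_nhds_right.1 hL)) hderiv hlim
  have hcovec {y} {l : Eu n →L[ℝ] ℝ} (hl : HasFDerivAt (fun u => c ((χ x).symm u) y) l (χ x x)) :
      covec c x y = l :=
    (mfderiv_eq_fderiv_chart hl.differentiableAt).trans hl.fderiv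
  have hxx : Tendsto (fun y => (y, χ x x)) (𝓝[Λ] y₀) (𝓝[Λ] y₀ ×ˢ 𝓝 (χ x x)) :=
    tendsto_id.prodMk tendsto_const_nhds
  rw [hcovec hL₀]
  exact (hL.comp hxx).congr' ((hxx.eventually hderiv).mono fun y hy => (hcovec hy).symm)

theorem continuousOn_covec_closure (hΩ : IsOpen Ω) (hΛ : IsOpen Λ)
    (hA0 : CostA0 (n := n) c Ω Λ) (hx : x ∈ Ω) :
    ContinuousOn (covec (n := n) c x) (closure Λ) :=
  continuousOn_closure_of_tendsto fun _ hy => tendsto_covec hΩ hΛ hA0 hx hy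

namespace RegularCost

theorem continuousOn_dualExp [Nonempty N] (H : RegularCost n c Ω Λ) (hx : x ∈ Ω) :
    ContinuousOn (dualExp c Λ x) (covec (n := n) c x '' Λ) := by
  rintro _ ⟨y, hy, rfl⟩
  have hchart : ContinuousAt (fun p => (χ y).symm (χ y (dualExp (n := n) c Λ x p)))
      (covec c x y) := by
    refine ContinuousAt.comp (g := (χ y).symm) ?_ (H.contDiffAt_chart_dualExp hx hy).1.continuousAt
    rw [H.dualExp_covec hx hy]
    exact continuousAt_extChartAt_symm y
  refine (hchart.congr ?_).continuousWithinAt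
  filter_upwards [H.eventually_dualExp hx hy] with p ⟨_, hsource, _⟩
  exact (χ y).left_inv hsource

theorem continuousOn_dualExp_closure [T2Space N] [Nonempty N] (H : RegularCost n c Ω Λ)
    (hA0 : CostA0 (n := n) c Ω Λ) (hx : x ∈ Ω) (hinj : InjOn (covec (n := n) c x) (closure Λ)) :
    ContinuousOn (dualExp c (closure Λ) x) (covec (n := n) c x '' closure Λ) := by
  have : LocallyCompactSpace N := ChartedSpace.locallyCompactSpace (Eu n) N
  have hleft : LeftInvOn (dualExp c (closure Λ) x) (covec (n := n) c x) (closure Λ) :=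
    hinj.leftInvOn_invFunOn
  refine continuousOn_leftInverse_closure
    (continuousOn_covec_closure H.isOpen_left H.isOpen_right hA0 hx)
    (H.convex_right x hx) hleft ((H.continuousOn_dualExp hx).congr ?_)
  rintro _ ⟨y, hy, rfl⟩
  rw [hleft (subset_closure hy), H.dualExp_covec hx hy]

theorem quasiconvexOn_cost_sub_cost_closure [T2Space N] [Nonempty M] [Nonempty N]
    (H : RegularCost n c Ω Λ) (hA0 : CostA0 (n := n) c Ω Λ)
    (hcurv : ∀ x ∈ Ω, ∀ y ∈ Λ, CrossConcaveAt (n := n) c Λ x y)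
    (hx : x ∈ Ω) (hinj : InjOn (covec (n := n) c x) (closure Λ))
    (hconv : Convex ℝ (covec (n := n) c x '' closure Λ)) {z : M} (hz : z ∈ Ω) :
    QuasiconvexOn ℝ (covec (n := n) c x '' closure Λ)
      fun p => c x (dualExp (n := n) c (closure Λ) x p) - c z (dualExp c (closure Λ) x p) := by
  have hleft : LeftInvOn (dualExp c (closure Λ) x) (covec (n := n) c x) (closure Λ) :=
    hinj.leftInvOn_invFunOn
  have hcost {a : M} (ha : a ∈ Ω) :
      ContinuousOn (fun p => c a (dualExp (n := n) c (closure Λ) x p))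
        (covec (n := n) c x '' closure Λ) :=
    (continuousOn_cost_closure hA0 ha).comp (H.continuousOn_dualExp_closure hA0 hx hinj)
      (by rintro _ ⟨y, hy, rfl⟩; rwa [hleft hy])
  have hinner : QuasiconvexOn ℝ (covec (n := n) c x '' Λ)
      fun p => c x (dualExp (n := n) c (closure Λ) x p) - c z (dualExp c (closure Λ) x p) := by
    have heq : EqOn (dualExp (n := n) c (closure Λ) x) (dualExp c Λ x) (covec c x '' Λ) := by
      rintro _ ⟨y, hy, rfl⟩
      rw [hleft (subset_closure hy), H.dualExp_covec hx hy]
    intro r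
    convert H.quasiconvexOn_cost_sub_cost hcurv hx hz r using 1
    exact sep_ext_iff.2 fun p hp => by simp only [heq hp]
  exact quasiconvexOn_of_dense hinner (image_mono subset_closure)
    (continuousOn_covec_closure H.isOpen_left H.isOpen_right hA0 hx).image_closure hconv
    ((hcost hx).sub (hcost hz))

theorem convex_covec_contactSet [T2Space N] [Nonempty M] [Nonempty N] (H : RegularCost n c Ω Λ)
    (hA0 : CostA0 (n := n) c Ω Λ) (hcurv : ∀ x ∈ Ω, ∀ y ∈ Λ, CrossConcaveAt (n := n) c Λ x y)
    (hx : x ∈ Ω) (hinj : InjOn (covec (n := n) c x) (closure Λ)) {φ : M → ℝ}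
    (hcl : ¬ contactSet c Ω Λ φ x ⊆ Λ → Convex ℝ (covec (n := n) c x '' closure Λ)) :
    Convex ℝ (covec (n := n) c x '' contactSet c Ω Λ φ x) := by
  by_cases hinterior : contactSet c Ω Λ φ x ⊆ Λ
  · exact convex_image_contactSet hx hinterior subset_closure (fun y hy => H.dualExp_covec hx hy)
      fun z hz => H.quasiconvexOn_cost_sub_cost hcurv hx hz
  · exact convex_image_contactSet hx (sep_subset _ _) Subset.rfl hinj.leftInvOn_invFunOn
      fun z hz => H.quasiconvexOn_cost_sub_cost_closure hA0 hcurv hx hinj (hcl hinterior) hz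

theorem isConnected_contactSet [T2Space N] [Nonempty N] (H : RegularCost n c Ω Λ)
    (hA0 : CostA0 (n := n) c Ω Λ) (hx : x ∈ Ω) (hinj : InjOn (covec (n := n) c x) (closure Λ))
    {φ : M → ℝ} (hφ : IsCConvexFunction c Ω Λ φ)
    (hconv : Convex ℝ (covec (n := n) c x '' contactSet c Ω Λ φ x)) :
    IsConnected (contactSet c Ω Λ φ x) := by
  have hG : contactSet c Ω Λ φ x ⊆ closure Λ := sep_subset _ _
  refine ⟨contactSet_nonempty hφ hx, ?_⟩
  rw [← hinj.leftInvOn_invFunOn.image_image' hG]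
  exact hconv.isPreconnected.image _
    ((H.continuousOn_dualExp_closure hA0 hx hinj).mono (image_mono hG))

end RegularCost

end Boundary

theorem corollary3p2 {n : ℕ} {M N : Type*}
    [TopologicalSpace M] [T2Space M] [ChartedSpace (Eu n) M] [IsManifold 𝓘(ℝ, Eu n) ∞ M]
    [TopologicalSpace N] [T2Space N] [ChartedSpace (Eu n) N] [IsManifold 𝓘(ℝ, Eu n) ∞ N]
    (g : RiemMetric n M) (h : RiemMetric n N)
    (Ω : Set M) (hΩ : IsOpen Ω) (hΩ' : IsConnected Ω)
    (Λ : Set N) (hΛ : IsOpen Λ) (hΛ' : IsConnected Λ)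
    (c : M → N → ℝ)
    (hA0 : CostA0 (n := n) c Ω Λ) (hA1 : CostA1 g h c Ω Λ) (hA2 : CostA2 (n := n) c Ω Λ)
    (hcΛ : ∀ x ∈ Ω, IsCConvexAt g c Λ x)
    (hcΩ : ∀ y ∈ Λ, IsCConvexAt h (fun y x => c x y) Ω y)
    (hA3W : CostA3W g c Ω Λ)
    (φ : M → ℝ) (hφ : IsCConvexFunction c Ω Λ φ) (x : M) (hx : x ∈ Ω)
    -- only if the contact set reaches the boundary of `Λ`: also `Λ̄` is `c`-convex at `x`
    (hcl : ¬ contactSet c Ω Λ φ x ⊆ Λ → IsCConvexAt g c (closure Λ) x) :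
    IsCConvexAt g c (contactSet c Ω Λ φ x) x ∧ IsConnected (contactSet c Ω Λ φ x) := by
  have : Nonempty M := ⟨x⟩
  have : Nonempty N := hΛ'.nonempty.to_type
  have H : RegularCost n c Ω Λ := regularCost_of_hypotheses g h hΩ hΛ hA0 hA1 hA2 hcΛ hcΩ
  have hcurv : ∀ a ∈ Ω, ∀ b ∈ Λ, CrossConcaveAt (n := n) c Λ a b :=
    fun a ha b hb => RegularCost.crossConcaveAt g H hA3W ha hb
  have hinj : InjOn (covec (n := n) c x) (closure Λ) :=
    injOn_covec_of_injOn_negGrad g (hA1.1 x hx)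
  have hconv : Convex ℝ (covec (n := n) c x '' contactSet c Ω Λ φ x) :=
    H.convex_covec_contactSet hA0 hcurv hx hinj fun hG =>
      (isCConvexAt_iff_convex_covec g c _ x).1 (hcl hG)
  exact ⟨(isCConvexAt_iff_convex_covec g c _ x).2 hconv,
    H.isConnected_contactSet hA0 hx hinj hφ hconv⟩
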